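/- Let $2<\underline v\le\overline v$ be even integers and let $\overline p$ be an integer with $\overline p\ge\overline v/2+2$. Two agents jointly own an object; agent $i\in\{1,2\}$ has a value $v_i\in\{\underline v,\underline v+2,\dots,\overline v\}$, and $v_l<v_h$ denote the lower and the higher value, $l$ and $h$ the corresponding agents. In the loser-bid auction each agent bids in $\{0,1,\dots,\overline p\}$; the higher bidder receives the object and pays the lower bid to the other agent, with ties resolved uniformly at random. An agent of value $v_i$ has utility $v_i-p$ when receiving the object and paying $p$, and utility $p$ when being paid $p$ and receiving no object. A strategy of agent $i$ is a probability distribution $\sigma_i$ on the bids, $U_i(b\mid\sigma_{-i})$ is the expected utility of agent $i$ from the bid $b$ when the other agent plays $\sigma_{-i}$, and $\pi_i(\sigma)$ is the expected payoff of agent $i$ at the profile $\sigma=(\sigma_1,\sigma_2)$; $\pi(\sigma)=(\pi_1(\sigma),\pi_2(\sigma))$. The profile $\sigma$ is a Nash equilibrium if every bid in the support of $\sigma_i$ maximizes $U_i(\cdot\mid\sigma_{-i})$, for both $i$; it is efficient if $\pi_l(\sigma)+\pi_h(\sigma)=v_h$. It is weakly payoff monotone if for both $i$ and all bids $b,c$,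 $\sigma_i(b)>\sigma_i(c)$ implies $U_i(b\mid\sigma_{-i})>U_i(c\mid\sigma_{-i})$. An empirical equilibrium is a Nash equilibrium that is the limit of a sequence of weakly payoff monotone profiles. Let $ES=|v_h/2-v_l/2|$. Theorem. Let $v_l<v_h$ and let $\sigma$ be an efficient Nash equilibrium of the loser-bid auction. Then $\pi(\sigma)$ is the payoff profile of an empirical equilibrium if and only if 1. $\pi_l(\sigma)\ge \frac{v_l}{2}+ES$ if $ES\le 2$; 2. $\pi_l(\sigma)\ge \frac{v_l}{2}+\frac{ES}{2}+\frac12\left(\overline p-\frac{v_h}{2}\right)-\frac12$ if $ES>2$ and $\frac{v_h}{2}\ge\frac{v_l}{2}+\frac58\left(\overline p-\frac{v_l}{2}\right)$; 3. $\pi_l(\sigma)\ge \frac{v_l}{2}+\frac{4ES}{5}-\frac45$ if $ES>2$, $\frac{v_h}{2}<\frac{v_l}{2}+\frac58\left(\overline p-\frac{v_l}{2}\right)$ and $\frac{v_h}{2}>\overline p-\frac{7}{12}\left(\overline p-\frac{v_l}{2}\right)+\frac{7}{12}$; 4. $\pi_l(\sigma)> \frac{v_l}{2}+\frac{4ES}{5}-\frac45$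 if $ES>2$, $\frac{v_h}{2}<\frac{v_l}{2}+\frac58\left(\overline p-\frac{v_l}{2}\right)$ and $\frac{v_h}{2}\le\overline p-\frac{7}{12}\left(\overline p-\frac{v_l}{2}\right)+\frac{7}{12}$. -/

import Mathlib

open Filter Topology

namespace LoserBid

/-- The two agents. -/
abbrev Agent : Type := Fin 2

/-- The other agent. -/
def other (i : Agent) : Agent := 1 - i

/-- Bids `{0, 1, ..., pbar}`. -/
abbrev Bid (pbar : ℕ) : Type := Fin (pbar + 1)

/-- Admissible values `{vmin, vmin + 2, ..., vmax}` (for even `vmin`, `vmax`). -/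
def TypeSpace (vmin vmax : ℕ) : Set ℕ := {x | vmin ≤ x ∧ x ≤ vmax ∧ Even x}

/-- Utility of an agent of value `x` who receives the object and pays `p` to the other agent. -/
noncomputable def getUtility (x : ℕ) (p : ℝ) : ℝ := (x : ℝ) - p

/-- Utility of an agent who receives no object and is paid `p` by the other agent. -/
noncomputable def giveUtility (p : ℝ) : ℝ := p

/-- Expected utility of an agent of value `x` in the loser-bid auction, when this agent bids `b`
and the other agent bids `c`: the higher bidder receives the object and pays the lower bid to the
other agent; ties are resolved uniformly at random. -/
noncomputable def outcomeUtility {pbar : ℕ} (x : ℕ) (b c : Bid pbar) : ℝ :=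
  if c < b then getUtility x ((c : ℕ) : ℝ)
  else if b < c then giveUtility ((b : ℕ) : ℝ)
  else (1 / 2) * getUtility x ((b : ℕ) : ℝ) + (1 / 2) * giveUtility ((b : ℕ) : ℝ)

/-- A pair of real functions on the bids, one for each agent. -/
abbrev Profile (pbar : ℕ) : Type := Agent → Bid pbar → ℝ

/-- Each agent's function is a probability distribution on the bids. -/
def IsStrategyProfile {pbar : ℕ} (σ : Profile pbar) : Prop :=
  ∀ i, σ i ∈ stdSimplex ℝ (Bid pbar)

/-- Expected utility of agent `i` from bidding `b` when the other agent plays as in `σ`. -/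
noncomputable def bidUtility {pbar : ℕ} (v : Agent → ℕ) (σ : Profile pbar) (i : Agent)
    (b : Bid pbar) : ℝ :=
  ∑ c, outcomeUtility (v i) b c * σ (other i) c

/-- Expected payoff `π_i(σ)` of agent `i`. -/
noncomputable def payoff {pbar : ℕ} (v : Agent → ℕ) (σ : Profile pbar) (i : Agent) : ℝ :=
  ∑ b, σ i b * bidUtility v σ i b

/-- Nash equilibrium: every bid in the support of an agent's strategy is a best response. -/
def IsNash {pbar : ℕ} (v : Agent → ℕ) (σ : Profile pbar) : Prop :=
  IsStrategyProfile σ ∧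
    ∀ i b, 0 < σ i b → ∀ c, bidUtility v σ i c ≤ bidUtility v σ i b

/-- Weakly payoff monotone strategy profiles. -/
def IsWeaklyPayoffMonotone {pbar : ℕ} (v : Agent → ℕ) (σ : Profile pbar) : Prop :=
  IsStrategyProfile σ ∧
    ∀ i b c, σ i c < σ i b → bidUtility v σ i c < bidUtility v σ i b

/-- Empirical equilibrium: a Nash equilibrium that is the limit of a sequence of weakly payoff
monotone strategy profiles. -/
def IsEmpirical {pbar : ℕ} (v : Agent → ℕ) (σ : Profile pbar) : Prop :=
  IsNash v σ ∧
    ∃ s : ℕ → Profile pbar, (∀ n, IsWeaklyPayoffMonotone v (s n)) ∧ Tendsto s atTop (𝓝 σ)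

/-- Efficiency: the expected payoffs add up to the higher value. -/
def IsEfficient {pbar : ℕ} (v : Agent → ℕ) (σ : Profile pbar) : Prop :=
  ∑ i, payoff v σ i = ((max (v 0) (v 1) : ℕ) : ℝ)

/-- The equity surplus. -/
noncomputable def ES (v : Agent → ℕ) : ℝ := |(v 0 : ℝ) / 2 - (v 1 : ℝ) / 2|

end LoserBid

/-! Write the values as `2a < 2b`. Efficiency forbids `l` to win or tie, so each bid in the support
of `l` earns exactly itself; best response then leaves a single bid `d`. Moreover `a ≤ d ≤ b`, and
`h` bids only above `d`, with positive mass on `d + 1` (`exists_pureBid_of_efficient`). The payoffs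
are `d` and `2b - d`, so the question is which integers `d` occur; the answer is `Attainable`.

Let `d < b`, and let `f`, `g` be the distributions of `l`, `h` in a monotone profile near the
equilibrium. In the limit `h` is indifferent among all bids above `d`, so the trembles of `l` decide
their ranking. Let `T = d + n` end the initial run of bids above `d` that are no worse for `h` than
`d + 1`; each carries at least `g (d + 1)`. Since `l` strictly prefers `d` to `d + 1`, the mass
above `d + 1` is less than `(d - a) (g d + g (d + 1))`. This bounds `n` by `d - a + 1`, and in the
boundary case the mass above `T` matters too. It also forces `f` to decrease along the run. Against
such an `f` a run with `n + 4 ≤ 4 (b - d)` cannot stop before `pbar`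
(`attainable_of_payoffMonotone`).

Conversely, under these inequalities the limit profile can be taken with `h` uniform on `(d, T]` and
`l` at `d`; in the approximations `l` trembles equally over a set whose part above `d` is `(d, T]`
(`mkProfile_uniform_mem_closure`). For `d = b` the bid `b + 1` of `h` works
(`mkProfile_pureBid_succ_mem_closure`). Eliminating `n` gives the four cases (`attainable_iff`). -/

namespace LoserBid

/-! ### Arithmetic of the attainable payoffs -/

/-- `d` is the lower-value agent's payoff in some empirical equilibrium, for values `2 * a < 2 * b`;
`n` is the number of bids above `d` that the other agent uses. -/
def Attainable (a b pbar d : ℕ) : Prop :=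
  d = b ∨ d < b ∧ ∃ n, b + 1 ≤ d + n ∧ d + n ≤ pbar ∧ (4 * b ≤ 4 * d + n + 3 ∨ d + n = pbar) ∧
    n + a ≤ d + 1 ∧ (n + a = d + 1 → pbar + a < d + n + d)

theorem attainable_iff {a b pbar d : ℕ} (hab : a < b) (hbp : b + 2 ≤ pbar) (had : a ≤ d)
    (hdb : d ≤ b) :
    Attainable a b pbar d ↔
      (b ≤ a + 2 → b ≤ d) ∧
      (a + 2 < b → 3 * a + 5 * pbar ≤ 8 * b → pbar + a ≤ 2 * d + 1) ∧
      (a + 2 < b → 8 * b < 3 * a + 5 * pbar → 5 * pbar + 7 * a + 7 < 12 * b →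
        a + 4 * b ≤ 5 * d + 4) ∧
      (a + 2 < b → 8 * b < 3 * a + 5 * pbar → 12 * b ≤ 5 * pbar + 7 * a + 7 →
        a + 4 * b < 5 * d + 4) := by
  constructor
  · rintro (h | ⟨h, n, h1, h2, h3, h4, h5⟩) <;> refine ⟨?_, ?_, ?_, ?_⟩ <;> omega
  · rintro ⟨h1, h2, h3, h4⟩
    by_cases hd : d = b
    · exact Or.inl hd
    refine Or.inr ⟨by omega, ?_⟩
    -- Either the run may reach the top bid, or `n` is the least value allowed: the larger of `b + 1
    -- - d` and `4 * (b - d) - 3`, where the former wins only for `b = d + 1`.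
    by_cases hM : pbar + a ≤ 2 * d + 1
    · exact ⟨pbar - d, by omega, by omega, by omega, by omega, by omega⟩
    · by_cases hb : b = d + 1
      · exact ⟨2, by omega, by omega, by omega, by omega, by omega⟩
      · exact ⟨4 * (b - d) - 3, by omega, by omega, by omega, by omega, by omega⟩

/-! ### Expected utilities with natural-number bids -/

/-- Utility of a bid `c` against a bid `t` for an agent of value `2 * a`. -/
noncomputable def out (a : ℝ) (c t : ℕ) : ℝ :=
  if t < c then 2 * a - t else if c < t then (c : ℝ) else a

/-- Expected utility of the bid `c` for an agent of value `2 * a` against the mixed bid `f`. -/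
noncomputable def expUtility (a : ℝ) (pbar : ℕ) (f : ℕ → ℝ) (c : ℕ) : ℝ :=
  ∑ t ∈ Finset.range (pbar + 1), out a c t * f t

theorem outcomeUtility_eq_out {pbar x a : ℕ} (hx : x = 2 * a) (b c : Bid pbar) :
    outcomeUtility x b c = out a b c := by
  subst hx
  unfold outcomeUtility out getUtility giveUtility
  simp only [Fin.lt_def]
  split_ifs
  · push_cast; ring
  · rfl
  · push_cast; ring

/-- The extension of a function on bids by zero to all natural numbers. -/
noncomputable def extend {pbar : ℕ} (s : Bid pbar → ℝ) (t : ℕ) : ℝ :=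
  if h : t < pbar + 1 then s ⟨t, h⟩ else 0

@[simp] theorem extend_val {pbar : ℕ} (s : Bid pbar → ℝ) (t : Bid pbar) : extend s t = s t := by
  rw [extend, dif_pos t.2]

theorem sum_extend {pbar : ℕ} (s : Bid pbar → ℝ) (F : ℕ → ℝ) :
    ∑ t ∈ Finset.range (pbar + 1), F t * extend s t = ∑ t : Bid pbar, F t * s t := by
  rw [← Fin.sum_univ_eq_sum_range (fun t => F t * extend s t)]
  simp

theorem bidUtility_eq {pbar : ℕ} {v : Agent → ℕ} {i : Agent} {a : ℕ} (hv : v i = 2 * a)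
    (s : Profile pbar) (c : Bid pbar) :
    bidUtility v s i c = expUtility a pbar (extend (s (other i))) c := by
  unfold bidUtility expUtility
  rw [sum_extend]
  exact Finset.sum_congr rfl fun t _ => by rw [outcomeUtility_eq_out hv]

theorem expUtility_sub (a : ℝ) (pbar : ℕ) (f : ℕ → ℝ) (c c' : ℕ) :
    expUtility a pbar f c' - expUtility a pbar f c =
      ∑ t ∈ Finset.range (pbar + 1), (out a c' t - out a c t) * f t := by
  simp only [expUtility, ← Finset.sum_sub_distrib, sub_mul]

/-- Raising the bid by one turns a tie at `c` into a win and a loss to `c + 1` into a tie, each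
worth `a - c`; against higher bids the agent is paid one unit more. -/
theorem expUtility_succ (a : ℝ) {pbar : ℕ} (f : ℕ → ℝ) {c : ℕ} (hc : c < pbar) :
    expUtility a pbar f (c + 1) = expUtility a pbar f c + (a - c) * (f c + f (c + 1)) +
      ∑ t ∈ Finset.Ioc (c + 1) pbar, f t := by
  have h1 : ∑ t ∈ Finset.Ioc (c + 1) pbar, f t =
      ∑ t ∈ Finset.range (pbar + 1), if c + 1 < t then f t else 0 := by
    rw [← Finset.sum_filter]
    refine Finset.sum_congr ?_ fun _ _ => rfl
    ext t; simp only [Finset.mem_Ioc, Finset.mem_filter, Finset.mem_range]; omega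
  have h2 : (a - c) * f c = ∑ t ∈ Finset.range (pbar + 1), if t = c then (a - c) * f t else 0 := by
    rw [Finset.sum_ite_eq', if_pos (Finset.mem_range.2 (by omega))]
  have h3 : (a - c) * f (c + 1) =
      ∑ t ∈ Finset.range (pbar + 1), if t = c + 1 then (a - c) * f t else 0 := by
    rw [Finset.sum_ite_eq', if_pos (Finset.mem_range.2 (by omega))]
  rw [mul_add, h1, h2, h3, add_assoc, ← sub_eq_iff_eq_add', expUtility_sub,
    ← Finset.sum_add_distrib, ← Finset.sum_add_distrib]
  refine Finset.sum_congr rfl fun t _ => ?_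
  rcases lt_trichotomy t c with h | rfl | h
  · simp [out, h, h.ne, show t < c + 1 by omega, show t ≠ c + 1 by omega,
      show ¬ c + 1 < t by omega]
  · simp only [out, lt_add_one, lt_irrefl, if_true, if_false,
      (Nat.succ_ne_self t).symm, not_lt.2 (Nat.le_succ t)]
    ring
  · rcases (Nat.succ_le_of_lt h).eq_or_lt with h' | h'
    · obtain rfl : c + 1 = t := h'
      simp [out]
    · have h' : c + 1 < t := h'
      simp [out, h', h.ne', h.not_gt, h, show t ≠ c + 1 by omega, show ¬ t < c + 1 by omega]

theorem sum_Ioc_const_sub (K : ℝ) (s m : ℕ) :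
    ∑ t ∈ Finset.Ioc s (s + m), (K - t) = m * (K - s) - m * (m + 1) / 2 := by
  induction m with
  | zero => simp
  | succ m ih =>
    rw [← add_assoc, Finset.sum_Ioc_succ_top (by omega), ih]
    push_cast
    ring

/-! ### Necessity: constraints from a monotone profile -/

/-- The first bid above `d + 1` that is worse than `d + 1` against `f` lies above `b + 1`. -/
theorem exists_last_not_worse {b pbar d : ℕ} (hbp : b < pbar) {f : ℕ → ℝ}
    (hf : ∀ t, 0 ≤ f t) :
    ∃ T, b + 1 ≤ T ∧ T ≤ pbar ∧
      (∀ c, d < c → c ≤ T → expUtility b pbar f (d + 1) ≤ expUtility b pbar f c) ∧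
      (T = pbar ∨ expUtility b pbar f (T + 1) < expUtility b pbar f (d + 1)) := by
  have key : ∀ c, d < c → c ≤ b + 1 → expUtility b pbar f (d + 1) ≤ expUtility b pbar f c := by
    intro c hc
    induction c, hc using Nat.le_induction with
    | base => intro _; exact le_rfl
    | succ c hc ih =>
      intro hcb
      refine (ih (by omega)).trans ?_
      rw [expUtility_succ _ _ (by omega)]
      have h1 : 0 ≤ ∑ t ∈ Finset.Ioc (c + 1) pbar, f t := Finset.sum_nonneg fun t _ => hf t
      have h2 : (c : ℝ) ≤ b := by exact_mod_cast (by omega : c ≤ b)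
      have h3 : 0 ≤ ((b : ℝ) - c) * (f c + f (c + 1)) :=
        mul_nonneg (by linarith) (add_nonneg (hf _) (hf _))
      linarith
  by_cases h : ∃ c, d < c ∧ c ≤ pbar ∧ expUtility b pbar f c < expUtility b pbar f (d + 1)
  · classical
    obtain ⟨h1, h2, h3⟩ := Nat.find_spec h
    have hmin : ∀ {c}, c < Nat.find h → _ := fun {c} hc => Nat.find_min h hc
    obtain ⟨T, hT⟩ : ∃ T, Nat.find h = T + 1 := ⟨Nat.find h - 1, by omega⟩
    rw [hT] at h1 h2 h3 hmin
    refine ⟨T, ?_, by omega, fun c hc hcT => ?_, Or.inr h3⟩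
    · by_contra hlt
      exact absurd (key (T + 1) h1 (by omega)) (not_le.2 h3)
    · by_contra hlt
      exact hmin (by omega : c < T + 1) ⟨hc, by omega, not_le.1 hlt⟩
  · push Not at h
    exact ⟨pbar, by omega, le_rfl, h, Or.inl rfl⟩

/-- Against an opponent whose probabilities decrease from `d + 1` to `T`, a bid above `T` is no
worse than `d + 1` when `T` is close enough to `d`. -/
theorem expUtility_le_of_antitone {b pbar d T : ℕ} (hdb : d < b) (hdT : d < T) (hT : T < pbar)
    (hn : T + 4 ≤ d + 4 * (b - d)) {f : ℕ → ℝ} (hf : ∀ t, 0 ≤ f t)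
    (hanti : ∀ c c', d < c → c ≤ c' → c' ≤ T → f c' ≤ f c) :
    expUtility b pbar f (d + 1) ≤ expUtility b pbar f (T + 1) := by
  obtain ⟨m, rfl⟩ : ∃ m, T = d + 1 + m := ⟨T - (d + 1), by omega⟩
  obtain ⟨β, rfl⟩ : ∃ β, b = d + 1 + β := ⟨b - (d + 1), by omega⟩
  have hmβ : m + 1 ≤ 4 * β := by omega
  -- Opposing bids below `d + 1` cancel, and those above `T` contribute nonnegatively and are
  -- dropped.
  have hd : expUtility ((d + 1 + β : ℕ) : ℝ) pbar f (d + 1 + m + 1) -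
      expUtility ((d + 1 + β : ℕ) : ℝ) pbar f (d + 1) ≥ β * f (d + 1) +
        ∑ t ∈ Finset.Ioc (d + 1) (d + 1 + m), ((d + 1 + 2 * β : ℕ) - (t : ℝ)) * f t := by
    have e1 : ∑ t ∈ Finset.Ioc (d + 1) (d + 1 + m), ((d + 1 + 2 * β : ℕ) - (t : ℝ)) * f t =
        ∑ t ∈ Finset.range (pbar + 1), if t ∈ Finset.Ioc (d + 1) (d + 1 + m) then
          ((d + 1 + 2 * β : ℕ) - (t : ℝ)) * f t else 0 := by
      rw [← Finset.sum_filter]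
      refine Finset.sum_congr ?_ fun _ _ => rfl
      ext t; simp only [Finset.mem_Ioc, Finset.mem_filter, Finset.mem_range]; omega
    have e2 : β * f (d + 1) =
        ∑ t ∈ Finset.range (pbar + 1), if t = d + 1 then β * f t else 0 := by
      rw [Finset.sum_ite_eq', if_pos (Finset.mem_range.2 (by omega))]
    rw [expUtility_sub, e1, e2, ← Finset.sum_add_distrib]
    refine Finset.sum_le_sum fun t _ => ?_
    simp only [Finset.mem_Ioc]
    rcases lt_trichotomy t (d + 1) with h | rfl | h
    · simp [out, h, show t < d + 1 + m + 1 by omega, h.ne, h.not_gt]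
    · simp only [out, lt_irrefl, if_false, if_true, false_and, add_zero,
        show d + 1 < d + 1 + m + 1 by omega]
      push_cast
      exact le_of_eq (by ring)
    · rcases lt_trichotomy t (d + 1 + m + 1) with h' | rfl | h'
      · simp only [out, h, h', h.ne', h.not_gt, true_and, if_true, if_false, zero_add,
          show t ≤ d + 1 + m by omega]
        push_cast
        exact le_of_eq (by ring)
      · have := mul_nonneg (Nat.cast_nonneg (α := ℝ) β) (hf (d + 1 + m + 1))
        simp only [out, h, h.ne', h.not_gt, lt_irrefl, if_true, if_false, zero_add,
          show ¬ d + 1 + m + 1 ≤ d + 1 + m by omega, and_false]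
        push_cast
        linarith
      · have := mul_nonneg (Nat.cast_nonneg (α := ℝ) (m + 1)) (hf t)
        simp only [out, h, h', h.ne', h.not_gt, h'.not_gt, if_true, if_false, zero_add,
          show ¬ t ≤ d + 1 + m by omega, and_false]
        push_cast at this ⊢
        linarith
  -- The coefficients change sign from plus to minus at `d + 1 + 2 * β`, so replacing the decreasing
  -- `f` by its value there only lowers the sum; the minimum keeps the pivot within the range of
  -- monotonicity.
  set r := min (d + 1 + 2 * β) (d + 1 + m) with hr
  have hr0 := hf r
  have h1 : (β : ℝ) * f r ≤ β * f (d + 1) :=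
    mul_le_mul_of_nonneg_left (hanti _ _ (by omega) (by omega) (by omega)) (Nat.cast_nonneg _)
  have h2 : ∑ t ∈ Finset.Ioc (d + 1) (d + 1 + m), ((d + 1 + 2 * β : ℕ) - (t : ℝ)) * f r ≤
      ∑ t ∈ Finset.Ioc (d + 1) (d + 1 + m), ((d + 1 + 2 * β : ℕ) - (t : ℝ)) * f t := by
    refine Finset.sum_le_sum fun t ht => ?_
    rw [Finset.mem_Ioc] at ht
    rcases le_total t (d + 1 + 2 * β) with h | h
    · have h' : (t : ℝ) ≤ (d + 1 + 2 * β : ℕ) := by exact_mod_cast h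
      exact mul_le_mul_of_nonneg_left (hanti _ _ (by omega) (by omega) (by omega)) (by linarith)
    · have h' : ((d + 1 + 2 * β : ℕ) : ℝ) ≤ t := by exact_mod_cast h
      exact mul_le_mul_of_nonpos_left (hanti _ _ (by omega) (by omega) (by omega)) (by linarith)
  rw [← Finset.sum_mul, sum_Ioc_const_sub] at h2
  have h3 : 0 ≤ (β : ℝ) + (m * ((d + 1 + 2 * β : ℕ) - ((d + 1 : ℕ) : ℝ)) - m * (m + 1) / 2) := by
    have h4 : m * (m + 1) ≤ 2 * β + 4 * (β * m) := by
      rcases le_total m (2 * β) with h | h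
      · nlinarith [Nat.mul_le_mul_left m h]
      · obtain ⟨k, rfl⟩ := Nat.exists_eq_add_of_le h
        nlinarith [Nat.mul_le_mul_left (2 * β + k) hmβ]
    have h4' : (m : ℝ) * (m + 1) ≤ 2 * β + 4 * (β * m) := by exact_mod_cast h4
    push_cast
    nlinarith
  have h5 := mul_nonneg h3 hr0
  linarith

/-- Here `f` belongs to `l` and `g` to `h`; `h1`, `h2`, `h3` record what closeness to the
equilibrium supplies. -/
theorem attainable_of_payoffMonotone {a b pbar d : ℕ} (had : a ≤ d) (hdb : d < b) (hbp : b < pbar)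
    {f g : ℕ → ℝ} (hf : ∀ t, 0 ≤ f t) (hg : ∀ t, 0 ≤ g t)
    (hfm : ∀ c c', c ≤ pbar → c' ≤ pbar → f c < f c' →
      expUtility a pbar g c < expUtility a pbar g c')
    (hgm : ∀ c c', c ≤ pbar → c' ≤ pbar → g c < g c' →
      expUtility b pbar f c < expUtility b pbar f c')
    (h1 : f (d + 1) < f d) (h2 : ∀ c, d < c → c ≤ pbar → g d ≤ g c)
    (h3 : ((d : ℝ) - a) * g d < g (d + 1)) : Attainable a b pbar d := by
  obtain ⟨T, hbT, hTp, hT, hTlast⟩ := exists_last_not_worse hbp hf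
  obtain ⟨n, rfl⟩ : ∃ n, T = d + 1 + n := ⟨T - (d + 1), by omega⟩
  obtain ⟨k, rfl⟩ : ∃ k, pbar = d + 1 + n + k := ⟨pbar - (d + 1 + n), by omega⟩
  have hmin : ∀ c, d < c → c ≤ d + 1 + n → g (d + 1) ≤ g c := by
    intro c hc hcT
    by_contra hlt
    exact absurd (hT c hc hcT) (not_le.2 (hgm _ _ (by omega) (by omega) (not_le.1 hlt)))
  have hstep : ((d : ℝ) - a) * (g d + g (d + 1)) >
      ∑ t ∈ Finset.Ioc (d + 1) (d + 1 + n + k), g t := by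
    have := hfm _ _ (by omega) (by omega) h1
    rw [expUtility_succ _ _ (by omega)] at this
    linarith
  have hsum : ∑ t ∈ Finset.Ioc (d + 1) (d + 1 + n + k), g t ≥ n * g (d + 1) + k * g d := by
    have e1 := Finset.sum_Ioc_consecutive g (by omega : d + 1 ≤ d + 1 + n)
      (by omega : d + 1 + n ≤ d + 1 + n + k)
    have e2 := Finset.card_nsmul_le_sum (Finset.Ioc (d + 1) (d + 1 + n)) g (g (d + 1))
      fun t ht => hmin t (by have := Finset.mem_Ioc.1 ht; omega) (Finset.mem_Ioc.1 ht).2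
    have e3 := Finset.card_nsmul_le_sum (Finset.Ioc (d + 1 + n) (d + 1 + n + k)) g (g d)
      fun t ht => h2 t (by have := Finset.mem_Ioc.1 ht; omega) (Finset.mem_Ioc.1 ht).2
    simp only [Nat.card_Ioc, add_tsub_cancel_left, nsmul_eq_mul] at e2 e3
    linarith
  have had' : (a : ℝ) ≤ d := by exact_mod_cast had
  -- Going from `c` to `c + 1` hurts `l` at least as much as going from `d` to `d + 1`: the tail is
  -- smaller, the factor `c - a` larger, and `g c + g (c + 1)` is at least `g (d + 1) + g d`.
  have hanti1 : ∀ c, d < c → c ≤ d + 1 + n → c < d + 1 + n + k → f (c + 1) ≤ f c := by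
    intro c hc hcT hcp
    by_contra hlt
    have h4 := hfm _ _ (by omega) (by omega) (not_le.1 hlt)
    rw [expUtility_succ _ _ hcp] at h4
    have h5 : ∑ t ∈ Finset.Ioc (c + 1) (d + 1 + n + k), g t ≤
        ∑ t ∈ Finset.Ioc (d + 1) (d + 1 + n + k), g t :=
      Finset.sum_le_sum_of_subset_of_nonneg (Finset.Ioc_subset_Ioc_left (by omega))
        fun t _ _ => hg t
    have h6 := hmin c hc hcT
    have h7 := h2 (c + 1) (by omega) (by omega)
    have h8 : (d : ℝ) ≤ c := by exact_mod_cast hc.le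
    have h9 : ((d : ℝ) - a) * (g d + g (d + 1)) ≤ (c - a) * (g c + g (c + 1)) :=
      mul_le_mul (by linarith) (by linarith) (add_nonneg (hg _) (hg _)) (by linarith)
    nlinarith
  refine Or.inr ⟨hdb, n + 1, by omega, by omega, ?_, ?_, ?_⟩
  · by_contra! hcon
    have hanti : ∀ c c', d < c → c ≤ c' → c' ≤ d + 1 + n → f c' ≤ f c := by
      intro c c' hc hcc'
      induction c', hcc' using Nat.le_induction with
      | base => intro _; exact le_rfl
      | succ c' hc' ih =>
        intro h
        exact (hanti1 c' (by omega) (by omega) (by omega)).trans (ih (by omega))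
    have h4 := expUtility_le_of_antitone hdb (by omega) (by omega) (by omega) hf hanti
      (pbar := d + 1 + n + k)
    rcases hTlast with h | h
    · omega
    · exact absurd h4 (not_le.2 h)
  · by_contra! hcon
    have h4 : (d : ℝ) - a + 1 ≤ n := by
      have : (d : ℝ) + 1 ≤ n + a := by exact_mod_cast (by omega : d + 1 ≤ n + a)
      linarith
    have h5 := mul_le_mul_of_nonneg_right h4 (hg (d + 1))
    have h6 := mul_nonneg (Nat.cast_nonneg (α := ℝ) k) (hg d)
    nlinarith
  · intro heq
    have h4 : (d : ℝ) - a = n := by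
      have : (d : ℝ) = n + a := by exact_mod_cast (by omega : d = n + a)
      linarith
    rw [h4] at hstep
    by_contra! hcon
    have h5 : (n : ℝ) ≤ k := by exact_mod_cast (by omega : n ≤ k)
    have h6 := mul_le_mul_of_nonneg_right h5 (hg d)
    linarith

/-! ### Two-agent profiles and trembles of a pure bid -/

/-- The profile in which agent `l` plays `f` and the other agent plays `g`. -/
def mkProfile (pbar : ℕ) (l : Agent) (f g : ℕ → ℝ) : Profile pbar :=
  fun i c => if i = l then f c else g c

/-- The pure bid `d`. -/
noncomputable def pureBid (d c : ℕ) : ℝ := if c = d then 1 else 0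

theorem other_ne (i : Agent) : other i ≠ i := by
  revert i; decide

theorem other_other (i : Agent) : other (other i) = i := by
  revert i; decide

theorem eq_other_of_ne {i j : Agent} (h : i ≠ j) : i = other j := by
  revert i j; decide

theorem expUtility_congr {a : ℝ} {pbar : ℕ} {f g : ℕ → ℝ} (h : ∀ t ≤ pbar, f t = g t) (c : ℕ) :
    expUtility a pbar f c = expUtility a pbar g c :=
  Finset.sum_congr rfl fun t ht => by rw [h t (Nat.lt_succ_iff.1 (Finset.mem_range.1 ht))]

theorem bidUtility_mkProfile_left {pbar : ℕ} {v : Agent → ℕ} {l : Agent} {a : ℕ}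
    (hv : v l = 2 * a) (f g : ℕ → ℝ) (c : Bid pbar) :
    bidUtility v (mkProfile pbar l f g) l c = expUtility a pbar g c := by
  rw [bidUtility_eq hv]
  refine expUtility_congr (fun t ht => ?_) c
  simp [extend, mkProfile, other_ne, Nat.lt_succ_of_le ht]

theorem bidUtility_mkProfile_right {pbar : ℕ} {v : Agent → ℕ} {l : Agent} {b : ℕ}
    (hv : v (other l) = 2 * b) (f g : ℕ → ℝ) (c : Bid pbar) :
    bidUtility v (mkProfile pbar l f g) (other l) c = expUtility b pbar f c := by
  rw [bidUtility_eq hv]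
  refine expUtility_congr (fun t ht => ?_) c
  simp [extend, mkProfile, other_other, Nat.lt_succ_of_le ht]

theorem isStrategyProfile_mkProfile {pbar : ℕ} {l : Agent} {f g : ℕ → ℝ}
    (hf : ∀ t ≤ pbar, 0 ≤ f t) (hg : ∀ t ≤ pbar, 0 ≤ g t)
    (hf1 : ∑ t ∈ Finset.range (pbar + 1), f t = 1) (hg1 : ∑ t ∈ Finset.range (pbar + 1), g t = 1) :
    IsStrategyProfile (mkProfile pbar l f g) := by
  intro i
  by_cases hi : i = l
  · refine ⟨fun c => ?_, ?_⟩
    · simpa [mkProfile, hi] using hf c (Nat.lt_succ_iff.1 c.2)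
    · simpa [mkProfile, hi, Fin.sum_univ_eq_sum_range f] using hf1
  · refine ⟨fun c => ?_, ?_⟩
    · simpa [mkProfile, hi] using hg c (Nat.lt_succ_iff.1 c.2)
    · simpa [mkProfile, hi, Fin.sum_univ_eq_sum_range g] using hg1

theorem isWeaklyPayoffMonotone_mkProfile {pbar a b : ℕ} {v : Agent → ℕ} {l : Agent}
    (hvl : v l = 2 * a) (hvh : v (other l) = 2 * b) {f g : ℕ → ℝ}
    (hf : ∀ t ≤ pbar, 0 ≤ f t) (hg : ∀ t ≤ pbar, 0 ≤ g t)
    (hf1 : ∑ t ∈ Finset.range (pbar + 1), f t = 1) (hg1 : ∑ t ∈ Finset.range (pbar + 1), g t = 1)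
    (hfm : ∀ c ≤ pbar, ∀ c' ≤ pbar, f c < f c' →
      expUtility a pbar g c < expUtility a pbar g c')
    (hgm : ∀ c ≤ pbar, ∀ c' ≤ pbar, g c < g c' →
      expUtility b pbar f c < expUtility b pbar f c') :
    IsWeaklyPayoffMonotone v (mkProfile pbar l f g) := by
  refine ⟨isStrategyProfile_mkProfile hf hg hf1 hg1, fun i c c' h => ?_⟩
  by_cases hi : i = l
  · subst hi
    rw [bidUtility_mkProfile_left hvl, bidUtility_mkProfile_left hvl]
    exact hfm _ (Nat.lt_succ_iff.1 c'.2) _ (Nat.lt_succ_iff.1 c.2) (by simpa [mkProfile] using h)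
  · obtain rfl := eq_other_of_ne hi
    rw [bidUtility_mkProfile_right hvh, bidUtility_mkProfile_right hvh]
    exact hgm _ (Nat.lt_succ_iff.1 c'.2) _ (Nat.lt_succ_iff.1 c.2)
      (by simpa [mkProfile, other_ne] using h)

theorem expUtility_pureBid {b : ℝ} {pbar d : ℕ} (hd : d ≤ pbar) (c : ℕ) :
    expUtility b pbar (pureBid d) c = out b c d := by
  simp [expUtility, pureBid, Nat.lt_succ_of_le hd]

theorem sum_pureBid {pbar d : ℕ} (hd : d ≤ pbar) :
    ∑ t ∈ Finset.range (pbar + 1), pureBid d t = 1 := by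
  simp [pureBid, Nat.lt_succ_of_le hd]

/-- `pureBid d` trembling to each bid in `A` with probability `ε`. -/
noncomputable def tremble (d : ℕ) (A : Finset ℕ) (ε : ℝ) (c : ℕ) : ℝ :=
  (1 - A.card * ε) * pureBid d c + if c ∈ A then ε else 0

theorem sum_mul_tremble {pbar d : ℕ} (hd : d ≤ pbar) {A : Finset ℕ}
    (hA : A ⊆ Finset.range (pbar + 1)) (ε : ℝ) (F : ℕ → ℝ) :
    ∑ t ∈ Finset.range (pbar + 1), F t * tremble d A ε t =
      F d + ε * (∑ t ∈ A, F t - A.card * F d) := by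
  simp only [tremble, mul_add, Finset.sum_add_distrib, mul_ite, mul_zero, Finset.sum_ite_mem,
    Finset.inter_eq_right.2 hA, pureBid, mul_one, Finset.sum_ite_eq', Finset.mem_range,
    Nat.lt_succ_of_le hd, if_true, ← Finset.sum_mul]
  ring

/-- Trembling equally over an upper contour set of its own utility keeps `l` monotone. The
comparisons of `h` become lexicographic: first against `d`, then, at order `ε`, against the
trembles. Trembles below `d` do not separate bids of at least `d`, which all beat them, so only `(d,
K]` counts. -/
theorem mkProfile_pureBid_mem_closure {pbar a b d K : ℕ} {v : Agent → ℕ} {l : Agent}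
    (hvl : v l = 2 * a) (hvh : v (other l) = 2 * b) (hd : d ≤ pbar) (hK : K ≤ pbar) {x : ℕ → ℝ}
    (hx0 : ∀ t ≤ pbar, 0 ≤ x t) (hx1 : ∑ t ∈ Finset.range (pbar + 1), x t = 1)
    (hmax : ∀ c ≤ pbar, c ≠ d → expUtility a pbar x c < expUtility a pbar x d)
    (hA : ∀ c ≤ pbar, d < c → (expUtility a pbar x K ≤ expUtility a pbar x c ↔ c ≤ K))
    (hx : ∀ c ≤ pbar, ∀ c' ≤ pbar, x c < x c' → out b c d < out b c' d ∨
      d ≤ c ∧ d ≤ c' ∧ out b c d = out b c' d ∧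
        ∑ t ∈ Finset.Ioc d K, out b c t < ∑ t ∈ Finset.Ioc d K, out b c' t) :
    mkProfile pbar l (pureBid d) x ∈ closure {s | IsWeaklyPayoffMonotone v s} := by
  classical
  set A := (Finset.range (pbar + 1)).filter
    fun c => c ≠ d ∧ expUtility a pbar x K ≤ expUtility a pbar x c with hAdef
  have hAr : A ⊆ Finset.range (pbar + 1) := Finset.filter_subset _ _
  have hdA : d ∉ A := by simp [hAdef]
  have hlim : Tendsto (fun ε : ℝ => mkProfile pbar l (tremble d A ε) x) (𝓝[>] 0)
      (𝓝 (mkProfile pbar l (pureBid d) x)) := by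
    have hc : Continuous fun ε : ℝ => mkProfile pbar l (tremble d A ε) x := by
      refine continuous_pi fun i => continuous_pi fun c => ?_
      unfold mkProfile tremble
      split_ifs <;> fun_prop
    have h0 : mkProfile pbar l (tremble d A 0) x = mkProfile pbar l (pureBid d) x := by
      ext i c; simp [mkProfile, tremble]
    rw [← h0]
    exact (hc.tendsto 0).mono_left nhdsWithin_le_nhds
  refine mem_closure_of_tendsto hlim ?_
  have hU : ∀ ε c, expUtility b pbar (tremble d A ε) c =
      out b c d + ε * (∑ t ∈ A, out b c t - A.card * out b c d) :=
    fun ε c => sum_mul_tremble hd hAr ε _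
  have hev : ∀ᶠ ε in 𝓝[>] (0 : ℝ), ∀ c ∈ Finset.range (pbar + 1), ∀ c' ∈ Finset.range (pbar + 1),
      x c < x c' →
      expUtility b pbar (tremble d A ε) c < expUtility b pbar (tremble d A ε) c' := by
    rw [Filter.eventually_all_finset]
    intro c hc
    rw [Filter.eventually_all_finset]
    intro c' hc'
    rw [Finset.mem_range, Nat.lt_succ_iff] at hc hc'
    by_cases hxc : x c < x c'
    swap
    · exact Eventually.of_forall fun _ h => absurd h hxc
    rcases hx c hc c' hc' hxc with h | ⟨hdc, hdc', heq, hlt⟩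
    · have hcont : ∀ c, ContinuousAt (fun ε => expUtility b pbar (tremble d A ε) c) 0 := by
        intro c
        simp only [hU]
        fun_prop
      have := (hcont c).eventually_lt (hcont c') (by simpa [hU] using h)
      exact (this.filter_mono nhdsWithin_le_nhds).mono fun _ h _ => h
    · have hsum : ∑ t ∈ A, out b c t < ∑ t ∈ A, out b c' t := by
        rw [← sub_pos, ← Finset.sum_sub_distrib] at hlt ⊢
        rwa [← Finset.sum_subset (s₁ := Finset.Ioc d K)]
        · intro t ht
          rw [Finset.mem_Ioc] at ht
          exact Finset.mem_filter.2 ⟨Finset.mem_range.2 (by omega), by omega,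
            (hA t (by omega) ht.1).2 ht.2⟩
        · intro t ht hnt
          obtain ⟨ht1, ht2, ht3⟩ := Finset.mem_filter.1 ht
          rw [Finset.mem_range, Nat.lt_succ_iff] at ht1
          have htd : t < d := by
            by_contra hlt'
            have h1 : d < t := by omega
            exact hnt (Finset.mem_Ioc.2 ⟨h1, (hA t ht1 h1).1 ht3⟩)
          simp [out, htd.trans_le hdc, htd.trans_le hdc']
      filter_upwards [self_mem_nhdsWithin] with ε hε _
      rw [hU, hU, heq]
      have := mul_lt_mul_of_pos_left hsum hε
      linarith
  have hev2 : ∀ᶠ ε : ℝ in 𝓝[>] (0 : ℝ), ε < 1 - A.card * ε := by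
    have : ContinuousAt (fun ε : ℝ => 1 - A.card * ε) 0 := by fun_prop
    exact (continuousAt_id.eventually_lt this (by simp)).filter_mono nhdsWithin_le_nhds
  filter_upwards [hev, hev2, self_mem_nhdsWithin] with ε h1 h2 hε
  have hε : 0 < ε := hε
  have htr : ∀ c, 0 ≤ tremble d A ε c := by
    intro c
    unfold tremble pureBid
    split_ifs <;> linarith
  refine isWeaklyPayoffMonotone_mkProfile hvl hvh (fun t _ => htr t) hx0 ?_ hx1 ?_
    fun c hc c' hc' => h1 c (by simpa [Nat.lt_succ_iff] using hc) c'
      (by simpa [Nat.lt_succ_iff] using hc')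
  · have := sum_mul_tremble hd hAr ε fun _ => 1
    simpa using this
  · intro c hc c' hc' hlt
    by_cases hc'd : c' = d
    · subst hc'd
      exact hmax c hc fun h => by simp [h] at hlt
    by_cases hc'A : c' ∈ A
    · have hcA : c ∉ A ∧ c ≠ d := by
        refine ⟨fun hcA => ?_, fun hcd => ?_⟩
        · have : c ≠ d := fun h => hdA (h ▸ hcA)
          simp [tremble, pureBid, hcA, hc'A, this, hc'd] at hlt
        · subst hcd
          simp [tremble, pureBid, hdA, hc'A, hc'd] at hlt
          linarith
      have h3 := (Finset.mem_filter.1 hc'A).2.2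
      refine lt_of_lt_of_le (not_le.1 fun h4 => hcA.1 ?_) h3
      exact Finset.mem_filter.2 ⟨by simpa [Nat.lt_succ_iff] using hc, hcA.2, h4⟩
    · have h3 : tremble d A ε c' = 0 := by simp [tremble, pureBid, hc'd, hc'A]
      exact absurd (htr c) (not_le.2 (h3 ▸ hlt))

/-! ### Sufficiency for `d < b`: spreading over `(d, T]` -/

/-- Against equal trembles on `(d, T]`, with `m = T - c`, the gain from `c'` over `c` is `(b - c) (1
+ 2m) - m (m + 1) / 2`. By `hdT`, `b - c ≤ m / 4`, so the gain is at most `-m / 4`; for `m = 0` it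
is `b - T < 0`. -/
theorem sum_out_lt_sum_out {b d T c c' : ℕ} (hdc : d < c) (hcT : c ≤ T) (hTc' : T < c')
    (hbT : b < T) (hdT : 4 * b ≤ 4 * d + (T - d) + 3) (hdb : d < b) :
    ∑ t ∈ Finset.Ioc d T, out b c' t < ∑ t ∈ Finset.Ioc d T, out b c t := by
  obtain ⟨e, rfl⟩ : ∃ e, c = e + 1 := ⟨c - 1, by omega⟩
  obtain ⟨m, rfl⟩ : ∃ m, T = e + 1 + m := ⟨T - (e + 1), by omega⟩
  rw [← sub_neg, ← Finset.sum_sub_distrib,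
    ← Finset.sum_Ioc_consecutive _ (by omega : d ≤ e + 1) (by omega : e + 1 ≤ e + 1 + m),
    Finset.sum_Ioc_succ_top (by omega)]
  have h1 : ∑ t ∈ Finset.Ioc d e, (out b c' t - out b (e + 1) t) = 0 := by
    refine Finset.sum_eq_zero fun t ht => ?_
    rw [Finset.mem_Ioc] at ht
    simp [out, show t < c' by omega, show t < e + 1 by omega]
  have h2 : ∑ t ∈ Finset.Ioc (e + 1) (e + 1 + m), (out b c' t - out b (e + 1) t) =
      ∑ t ∈ Finset.Ioc (e + 1) (e + 1 + m), ((2 * b - (e + 1 : ℕ) : ℝ) - t) := by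
    refine Finset.sum_congr rfl fun t ht => ?_
    rw [Finset.mem_Ioc] at ht
    simp only [out, show t < c' by omega, show ¬ t < e + 1 by omega, ht.1, if_true, if_false]
    ring
  rw [h1, h2, sum_Ioc_const_sub]
  simp only [out, show e + 1 < c' by omega, lt_irrefl, if_true, if_false]
  obtain ⟨r, hr⟩ : ∃ r, e + 1 + m = b + r + 1 := ⟨e + 1 + m - (b + 1), by omega⟩
  obtain ⟨q, hq⟩ : ∃ q, e + 1 + m = d + 1 + q := ⟨e + 1 + m - (d + 1), by omega⟩
  have h3 : 3 * m ≤ 4 * (r + 1) := by omega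
  have h4 : m * (3 * m) ≤ m * (4 * (r + 1)) := Nat.mul_le_mul_left _ h3
  have h5 : (m : ℝ) * (3 * m) ≤ m * (4 * (r + 1)) := by exact_mod_cast h4
  have h6 : (3 * m : ℝ) ≤ 4 * (r + 1) := by exact_mod_cast h3
  have h7 : (b : ℝ) = e + m - r := by
    have : (e + 1 + m : ℝ) = b + r + 1 := by exact_mod_cast hr
    linarith
  rw [h7]
  push_cast
  have hm : (0 : ℝ) ≤ m := Nat.cast_nonneg m
  have hr0 : (0 : ℝ) ≤ r := Nat.cast_nonneg r
  nlinarith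

/-- Probability `u` on each bid in `(d, T]` and probability `δ` on `d` and on each bid
above `T`. -/
noncomputable def spread (d T : ℕ) (u δ : ℝ) (c : ℕ) : ℝ :=
  if d < c ∧ c ≤ T then u else if d ≤ c then δ else 0

theorem spread_nonneg {d T : ℕ} {u δ : ℝ} (hu : 0 ≤ u) (hδ : 0 ≤ δ) (c : ℕ) :
    0 ≤ spread d T u δ c := by
  unfold spread
  split_ifs <;> first | assumption | exact le_rfl

theorem sum_Ioc_spread_high {d T c pbar : ℕ} {u δ : ℝ} (hdT : d < T) (hTc : T ≤ c)
    (hc : c ≤ pbar) :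
    ∑ t ∈ Finset.Ioc c pbar, spread d T u δ t = (pbar - c) * δ := by
  rw [Finset.sum_congr rfl (g := fun _ => δ)]
  · rw [Finset.sum_const, Nat.card_Ioc, nsmul_eq_mul, Nat.cast_sub hc]
  · intro t ht
    rw [Finset.mem_Ioc] at ht
    simp [spread, show ¬ t ≤ T by omega, show d ≤ t by omega]

theorem sum_Ioc_spread_low {d T c pbar : ℕ} {u δ : ℝ} (hdT : d < T) (hdc : d ≤ c) (hcT : c ≤ T)
    (hT : T ≤ pbar) :
    ∑ t ∈ Finset.Ioc c pbar, spread d T u δ t = (T - c) * u + (pbar - T) * δ := by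
  rw [← Finset.sum_Ioc_consecutive _ hcT hT, sum_Ioc_spread_high hdT le_rfl hT,
    Finset.sum_congr rfl (g := fun _ => u)]
  · rw [Finset.sum_const, Nat.card_Ioc, nsmul_eq_mul, Nat.cast_sub hcT]
  · intro t ht
    rw [Finset.mem_Ioc] at ht
    simp [spread, ht.2, show d < t by omega]

theorem sum_spread {d T pbar : ℕ} {u δ : ℝ} (hdT : d < T) (hT : T ≤ pbar) :
    ∑ t ∈ Finset.range (pbar + 1), spread d T u δ t = (T - d) * u + (pbar - T + 1) * δ := by
  have h : ∀ t, spread d T u δ t = (if d < t then spread d T u δ t else 0) +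
      if t = d then δ else 0 := by
    intro t
    rcases lt_trichotomy t d with h | rfl | h
    · simp [spread, h.ne, h.not_gt, h.not_ge]
    · simp [spread]
    · simp [h, h.ne']
  rw [Finset.sum_congr rfl fun t _ => h t, Finset.sum_add_distrib, ← Finset.sum_filter]
  have : (Finset.range (pbar + 1)).filter (fun t => d < t) = Finset.Ioc d pbar := by
    ext t; simp only [Finset.mem_Ioc, Finset.mem_filter, Finset.mem_range]; omega
  rw [this, sum_Ioc_spread_low hdT le_rfl hdT.le hT, Finset.sum_ite_eq',
    if_pos (Finset.mem_range.2 (by omega))]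
  ring

/-- The quadratic factor is generous here; it is needed where up to `pbar` steps each contribute an
error `pbar * δ`, as in `expUtility_spread_lt_of_gt`. -/
theorem natCast_mul_lt_of_spread {pbar : ℕ} {u δ : ℝ} (hδ : 0 < δ)
    (hδu : 2 * ((pbar : ℝ) + 1) ^ 2 * δ < u) {m : ℕ} (hm : m ≤ pbar) : (m : ℝ) * δ < u := by
  have h1 : (m : ℝ) ≤ pbar := by exact_mod_cast hm
  have h2 : (0 : ℝ) ≤ pbar := Nat.cast_nonneg _
  have h3 : (m : ℝ) ≤ 2 * ((pbar : ℝ) + 1) ^ 2 := by nlinarith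
  exact (mul_le_mul_of_nonneg_right h3 hδ.le).trans_lt hδu

theorem pos_of_spread {pbar : ℕ} {u δ : ℝ} (hδ : 0 < δ)
    (hδu : 2 * ((pbar : ℝ) + 1) ^ 2 * δ < u) : 0 < u := by
  simpa using natCast_mul_lt_of_spread hδ hδu (Nat.zero_le pbar)

theorem expUtility_spread_lt_of_lt {a d T pbar : ℕ} {u δ : ℝ} (hdT : d < T) (hT : T ≤ pbar)
    (hδ : 0 < δ) (hδu : 2 * ((pbar : ℝ) + 1) ^ 2 * δ < u) {c : ℕ} (hc : c < d) :
    expUtility a pbar (spread d T u δ) c < expUtility a pbar (spread d T u δ) d := by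
  have hu := pos_of_spread hδ hδu
  have hstep : ∀ c < d,
      expUtility a pbar (spread d T u δ) c < expUtility a pbar (spread d T u δ) (c + 1) := by
    intro c hc
    rw [expUtility_succ _ _ (by omega)]
    have h1 : spread d T u δ c = 0 := by simp [spread, hc.not_gt, hc.not_ge]
    have h2 : spread d T u δ (c + 1) ≤ δ := by
      simp only [spread, show ¬ d < c + 1 by omega, false_and, if_false]
      split_ifs
      · exact le_rfl
      · exact hδ.le
    have h3 : u ≤ ∑ t ∈ Finset.Ioc (c + 1) pbar, spread d T u δ t := by
      have h4 := Finset.single_le_sum (f := spread d T u δ) (s := Finset.Ioc (c + 1) pbar)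
        (a := d + 1) (fun t _ => spread_nonneg hu.le hδ.le t)
        (Finset.mem_Ioc.2 ⟨by omega, by omega⟩)
      have h5 : spread d T u δ (d + 1) = u := by simp [spread, Nat.succ_le_of_lt hdT]
      linarith
    have h4 := natCast_mul_lt_of_spread hδ hδu (m := c) (by omega)
    have h5 := spread_nonneg (d := d) (T := T) hu.le hδ.le (c + 1)
    have h6 : (c : ℝ) * spread d T u δ (c + 1) ≤ c * δ :=
      mul_le_mul_of_nonneg_left h2 (Nat.cast_nonneg _)
    have h7 := mul_nonneg (Nat.cast_nonneg (α := ℝ) a) h5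
    rw [h1]
    linarith
  have key : ∀ e, c + 1 ≤ e → e ≤ d →
      expUtility a pbar (spread d T u δ) c < expUtility a pbar (spread d T u δ) e := by
    intro e he
    induction e, he using Nat.le_induction with
    | base => exact fun _ => hstep c hc
    | succ e he ih => exact fun h => (ih (by omega)).trans (hstep e (by omega))
  exact key d hc le_rfl

/-- The difference is `(T + a - 2d - 1) u + (pbar - T + a - d) δ`. When the first coefficient
vanishes, only the small mass `δ` separates the two bids, which is the origin of the boundary
condition in `Attainable`. -/
theorem expUtility_spread_succ_lt {a d T pbar : ℕ} {u δ : ℝ} (had : a ≤ d) (hdT : d < T)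
    (hT : T ≤ pbar) (hTa : T + a ≤ 2 * d + 1) (hTa' : T + a = 2 * d + 1 → pbar + a < T + d)
    (hδ : 0 < δ) (hδu : 2 * ((pbar : ℝ) + 1) ^ 2 * δ < u) :
    expUtility a pbar (spread d T u δ) (d + 1) < expUtility a pbar (spread d T u δ) d := by
  rw [expUtility_succ _ _ (by omega), sum_Ioc_spread_low hdT (by omega) (by omega) hT]
  have h1 : spread d T u δ d = δ := by simp [spread]
  have h2 : spread d T u δ (d + 1) = u := by simp [spread, Nat.succ_le_of_lt hdT]
  have had' : (a : ℝ) ≤ d := by exact_mod_cast had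
  have hu := pos_of_spread hδ hδu
  rw [h1, h2]
  push_cast
  rcases hTa.lt_or_eq with h | h
  · have h3 : (T : ℝ) + a ≤ 2 * d := by exact_mod_cast (by omega : T + a ≤ 2 * d)
    have h4 := natCast_mul_lt_of_spread hδ hδu le_rfl
    have h5 : (0 : ℝ) ≤ T := Nat.cast_nonneg _
    nlinarith [mul_nonneg h5 hδ.le, mul_nonneg (sub_nonneg.2 had') hδ.le,
      mul_nonneg (sub_nonneg.2 h3) hu.le]
  · have h3 : (T : ℝ) + a = 2 * d + 1 := by exact_mod_cast h
    have h4 : (pbar : ℝ) + a < T + d := by exact_mod_cast hTa' h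
    have h5 : (a : ℝ) = 2 * d + 1 - T := by linarith
    rw [h5] at h4 ⊢
    nlinarith

theorem expUtility_spread_antitone {a d T pbar : ℕ} {u δ : ℝ} (had : a ≤ d) (hdT : d < T)
    (hT : T ≤ pbar) (hTa : T + a ≤ 2 * d + 1) (hδ : 0 < δ)
    (hδu : 2 * ((pbar : ℝ) + 1) ^ 2 * δ < u)
    {c c' : ℕ} (hc : d < c) (hcc' : c ≤ c') (hc' : c' ≤ T) :
    expUtility a pbar (spread d T u δ) c' ≤ expUtility a pbar (spread d T u δ) c := by
  have hu := pos_of_spread hδ hδu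
  induction c', hcc' using Nat.le_induction with
  | base => exact le_rfl
  | succ c' hcc' ih =>
    refine le_trans ?_ (ih (by omega))
    rw [expUtility_succ _ _ (by omega), sum_Ioc_spread_low hdT (by omega) (by omega) hT]
    have h1 : spread d T u δ c' = u := by
      simp [spread, show d < c' by omega, show c' ≤ T by omega]
    have h2 : spread d T u δ (c' + 1) = u := by
      simp [spread, show d < c' + 1 by omega, show c' + 1 ≤ T by omega]
    have h3 : (d : ℝ) + 1 ≤ c' := by exact_mod_cast (by omega : d + 1 ≤ c')
    have h4 : (T : ℝ) + a ≤ 2 * d + 1 := by exact_mod_cast hTa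
    have h5 : (a : ℝ) ≤ d := by exact_mod_cast had
    have h6 := natCast_mul_lt_of_spread hδ hδu le_rfl
    have h7 := mul_nonneg (Nat.cast_nonneg (α := ℝ) T) hδ.le
    rw [h1, h2]
    push_cast
    nlinarith [mul_nonneg (by linarith : 0 ≤ 2 * (c' - a : ℝ) - (T - (c' + 1)) - 1) hu.le]

theorem expUtility_spread_lt_of_gt {a d T pbar : ℕ} {u δ : ℝ} (had : a ≤ d) (hdT : d < T)
    (hδ : 0 < δ) (hδu : 2 * ((pbar : ℝ) + 1) ^ 2 * δ < u) {c : ℕ} (hc : T < c) (hcp : c ≤ pbar) :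
    expUtility a pbar (spread d T u δ) c < expUtility a pbar (spread d T u δ) T := by
  have hu := pos_of_spread hδ hδu
  -- The step past `T` loses `u` up to an error `pbar * δ`, and each later step regains at most
  -- `pbar * δ`.
  have key : ∀ e, T + 1 ≤ e → e ≤ pbar → expUtility a pbar (spread d T u δ) e ≤
      expUtility a pbar (spread d T u δ) T - u + (e - T : ℝ) * (pbar * δ) := by
    intro e he
    induction e, he using Nat.le_induction with
    | base =>
      intro h
      rw [expUtility_succ _ _ (by omega), sum_Ioc_spread_high hdT (by omega) (by omega)]
      have h1 : spread d T u δ T = u := by simp [spread, hdT]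
      have h2 : spread d T u δ (T + 1) = δ := by simp [spread, show d ≤ T + 1 by omega]
      have h3 : (a : ℝ) + 1 ≤ T := by exact_mod_cast (by omega : a + 1 ≤ T)
      rw [h1, h2]
      push_cast
      nlinarith [mul_nonneg (sub_nonneg.2 h3) (add_nonneg hu.le hδ.le),
        mul_nonneg (Nat.cast_nonneg (α := ℝ) T) hδ.le]
    | succ e he ih =>
      intro h
      rw [expUtility_succ _ _ (by omega), sum_Ioc_spread_high hdT (by omega) (by omega)]
      have h1 : spread d T u δ e = δ := by
        simp [spread, show ¬ e ≤ T by omega, show d ≤ e by omega]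
      have h2 : spread d T u δ (e + 1) = δ := by
        simp [spread, show ¬ e + 1 ≤ T by omega, show d ≤ e + 1 by omega]
      have h3 : (a : ℝ) ≤ e := by exact_mod_cast (by omega : a ≤ e)
      have := ih (by omega)
      rw [h1, h2]
      push_cast
      nlinarith [mul_nonneg (sub_nonneg.2 h3) hδ.le,
        mul_nonneg (Nat.cast_nonneg (α := ℝ) e) hδ.le]
  have h1 := key c hc hcp
  have h2 : (c : ℝ) ≤ pbar := by exact_mod_cast hcp
  have h3 : (0 : ℝ) ≤ pbar := Nat.cast_nonneg _
  have h4 : (c - T : ℝ) * (pbar * δ) ≤ pbar * (pbar * δ) :=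
    mul_le_mul_of_nonneg_right (by linarith [Nat.cast_nonneg (α := ℝ) T])
      (mul_nonneg h3 hδ.le)
  have h5 : (pbar : ℝ) * (pbar * δ) ≤ 2 * ((pbar : ℝ) + 1) ^ 2 * δ := by
    rw [← mul_assoc]
    exact mul_le_mul_of_nonneg_right (by nlinarith) hδ.le
  linarith

theorem expUtility_spread_lt_max {a d T pbar : ℕ} {u δ : ℝ} (had : a ≤ d) (hdT : d < T)
    (hT : T ≤ pbar) (hTa : T + a ≤ 2 * d + 1) (hTa' : T + a = 2 * d + 1 → pbar + a < T + d)
    (hδ : 0 < δ) (hδu : 2 * ((pbar : ℝ) + 1) ^ 2 * δ < u) {c : ℕ} (hcp : c ≤ pbar) (hcd : c ≠ d) :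
    expUtility a pbar (spread d T u δ) c < expUtility a pbar (spread d T u δ) d := by
  rcases lt_or_gt_of_ne hcd with h | h
  · exact expUtility_spread_lt_of_lt hdT hT hδ hδu h
  · refine lt_of_le_of_lt ?_ (expUtility_spread_succ_lt had hdT hT hTa hTa' hδ hδu)
    rcases le_or_gt c T with h' | h'
    · exact expUtility_spread_antitone had hdT hT hTa hδ hδu (by omega) h h'
    · exact (expUtility_spread_lt_of_gt had hdT hδ hδu h' hcp).le.trans
        (expUtility_spread_antitone had hdT hT hTa hδ hδu (by omega) hdT le_rfl)

theorem mkProfile_spread_mem_closure {a b d T pbar : ℕ} {v : Agent → ℕ} {l : Agent}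
    (hvl : v l = 2 * a) (hvh : v (other l) = 2 * b) {u δ : ℝ} (had : a ≤ d) (hdT : d < T)
    (hT : T ≤ pbar) (hTa : T + a ≤ 2 * d + 1) (hTa' : T + a = 2 * d + 1 → pbar + a < T + d)
    (hδ : 0 < δ) (hδu : 2 * ((pbar : ℝ) + 1) ^ 2 * δ < u)
    (hsum : (T - d) * u + (pbar - T + 1) * δ = 1) (hdb : d < b) (hbT : b < T)
    (hbn : 4 * b ≤ 4 * d + (T - d) + 3 ∨ T = pbar) :
    mkProfile pbar l (pureBid d) (spread d T u δ) ∈ closure {s | IsWeaklyPayoffMonotone v s} := by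
  have hu := pos_of_spread hδ hδu
  have hδ' : δ < u := by
    simpa using natCast_mul_lt_of_spread hδ hδu (m := 1) (by omega)
  refine mkProfile_pureBid_mem_closure hvl hvh (by omega) hT
    (fun t _ => spread_nonneg hu.le hδ.le t) (by rw [sum_spread hdT hT, hsum])
    (fun c hc hcd => expUtility_spread_lt_max had hdT hT hTa hTa' hδ hδu hc hcd)
    (fun c hc hdc => ⟨fun h => ?_, fun h => ?_⟩) (fun c hc c' hc' hlt => ?_)
  · by_contra hlt
    exact absurd (expUtility_spread_lt_of_gt had hdT hδ hδu (not_le.1 hlt) hc) (not_lt.2 h)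
  · exact expUtility_spread_antitone had hdT hT hTa hδ hδu hdc h le_rfl
  · have hdb' : (d : ℝ) < b := by exact_mod_cast hdb
    have hdc' : d ≤ c' := by
      by_contra h
      have h0 : spread d T u δ c' = 0 := by simp [spread, h, show ¬ d < c' by omega]
      exact absurd (spread_nonneg hu.le hδ.le c) (not_le.2 (h0 ▸ hlt))
    rcases lt_trichotomy c d with h | rfl | h
    · left
      have h1 : (c : ℝ) < b := by exact_mod_cast h.trans hdb
      rcases hdc'.eq_or_lt with rfl | h2
      · simpa [out, h, h.not_gt] using h1
      · simp only [out, h, h.not_gt, h2, if_true, if_false]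
        linarith
    · left
      rcases hdc'.eq_or_lt with rfl | h2
      · exact absurd hlt (lt_irrefl _)
      · simp only [out, h2, lt_irrefl, if_true, if_false]
        linarith
    · have hcT : T < c := by
        by_contra h'
        have h1 : spread d T u δ c = u := by simp [spread, h, not_lt.1 h']
        rw [h1] at hlt
        refine absurd hlt (not_lt.2 ?_)
        unfold spread
        split_ifs
        exacts [le_rfl, hδ'.le]
      have h1 : spread d T u δ c = δ := by simp [spread, h.le, not_le.2 hcT]
      have h2 : d < c' ∧ c' ≤ T := by
        by_contra h'
        rw [h1] at hlt
        simp [spread, h', hdc'] at hlt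
      refine Or.inr ⟨h.le, hdc', by simp [out, h, h2.1], ?_⟩
      exact sum_out_lt_sum_out h2.1 h2.2 hcT hbT (by omega) hdb

theorem mkProfile_uniform_mem_closure {a b d T pbar : ℕ} {v : Agent → ℕ} {l : Agent}
    (hvl : v l = 2 * a) (hvh : v (other l) = 2 * b) (had : a ≤ d) (hdT : d < T)
    (hT : T ≤ pbar) (hTa : T + a ≤ 2 * d + 1) (hTa' : T + a = 2 * d + 1 → pbar + a < T + d)
    (hdb : d < b) (hbT : b < T) (hbn : 4 * b ≤ 4 * d + (T - d) + 3 ∨ T = pbar) :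
    mkProfile pbar l (pureBid d) (spread d T (1 / (T - d)) 0) ∈
      closure {s | IsWeaklyPayoffMonotone v s} := by
  have hpos : (0 : ℝ) < T - d := sub_pos.2 (by exact_mod_cast hdT)
  -- The mass on `(d, T]` is normalized so that the total stays one while `δ` tends to zero.
  set F : ℝ → Profile pbar := fun δ =>
    mkProfile pbar l (pureBid d) (spread d T ((1 - (pbar - T + 1) * δ) / (T - d)) δ) with hF
  have hc : Continuous F := by
    refine continuous_pi fun i => continuous_pi fun c => ?_
    simp only [hF, mkProfile, spread]
    split_ifs <;> fun_prop
  have h0 : F 0 = mkProfile pbar l (pureBid d) (spread d T (1 / (T - d)) 0) := by simp [hF]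
  rw [← h0]
  have hlim : Tendsto F (𝓝[>] 0) (𝓝 (F 0)) := (hc.tendsto 0).mono_left nhdsWithin_le_nhds
  refine isClosed_closure.mem_of_tendsto hlim ?_
  have hev : ∀ᶠ δ : ℝ in 𝓝 0,
      2 * ((pbar : ℝ) + 1) ^ 2 * δ < (1 - (pbar - T + 1) * δ) / (T - d) := by
    refine ContinuousAt.eventually_lt (by fun_prop) (by fun_prop) ?_
    simpa using hpos
  filter_upwards [hev.filter_mono nhdsWithin_le_nhds, self_mem_nhdsWithin] with δ h1 h2
  refine mkProfile_spread_mem_closure hvl hvh had hdT hT hTa hTa' h2 h1 ?_ hdb hbT hbn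
  field_simp
  ring

/-! ### Sufficiency for `d = b` -/

/-- Probability `1 - 2 * δ` on `b + 1` and `δ` on each of `b` and `b + 2`. -/
noncomputable def peak (b : ℕ) (δ : ℝ) (c : ℕ) : ℝ :=
  δ * pureBid b c + (1 - 2 * δ) * pureBid (b + 1) c + δ * pureBid (b + 2) c

theorem sum_mul_peak {b pbar : ℕ} (hbp : b + 2 ≤ pbar) (δ : ℝ) (F : ℕ → ℝ) :
    ∑ t ∈ Finset.range (pbar + 1), F t * peak b δ t =
      δ * F b + (1 - 2 * δ) * F (b + 1) + δ * F (b + 2) := by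
  simp only [peak, pureBid, mul_add, mul_ite, mul_one, mul_zero, Finset.sum_add_distrib,
    Finset.sum_ite_eq', Finset.mem_range, show b < pbar + 1 by omega,
    show b + 1 < pbar + 1 by omega, show b + 2 < pbar + 1 by omega, if_true]
  ring

/-- Against the pure bid `b`, all bids of at least `b` tie for `h`, including `b` itself. Trembles
to `b + 1` alone would leave `b` and `b + 1` tied, so `b + 2` is added; `h` then ranks `b + 1`, `b`,
`b + 2`, higher bids. The mass `δ` on `b + 2` makes that bid strictly better for `l` than higher
ones, and `b` must then carry at least as much. -/
theorem mkProfile_peak_mem_closure {a b pbar : ℕ} {v : Agent → ℕ} {l : Agent}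
    (hvl : v l = 2 * a) (hvh : v (other l) = 2 * b) (hab : a < b) (hbp : b + 2 ≤ pbar) {δ : ℝ}
    (hδ : 0 < δ) (hδb : 4 * (b + 1) * δ < 1) :
    mkProfile pbar l (pureBid b) (peak b δ) ∈ closure {s | IsWeaklyPayoffMonotone v s} := by
  have hab' : (a : ℝ) + 1 ≤ b := by exact_mod_cast hab
  have ha0 : (0 : ℝ) ≤ a := Nat.cast_nonneg a
  have haδ : 0 ≤ a * δ := mul_nonneg ha0 hδ.le
  have hbδ : (a + 1) * δ ≤ b * δ := mul_le_mul_of_nonneg_right hab' hδ.le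
  have hδ1 : δ < 1 - 2 * δ := by nlinarith
  have hU : ∀ c, expUtility a pbar (peak b δ) c =
      δ * out a c b + (1 - 2 * δ) * out a c (b + 1) + δ * out a c (b + 2) :=
    fun c => sum_mul_peak hbp δ _
  have p0 : peak b δ b = δ := by simp [peak, pureBid]
  have p1 : peak b δ (b + 1) = 1 - 2 * δ := by simp [peak, pureBid]
  have p2 : peak b δ (b + 2) = δ := by simp [peak, pureBid]
  have p3 : ∀ c, c < b ∨ b + 2 < c → peak b δ c = 0 := by
    intro c hc
    simp [peak, pureBid, show c ≠ b by omega, show c ≠ b + 1 by omega, show c ≠ b + 2 by omega]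
  have hcases : ∀ c, c < b ∨ c = b ∨ c = b + 1 ∨ c = b + 2 ∨ b + 2 < c := by omega
  have u0 : expUtility a pbar (peak b δ) b = b - (b - a) * δ := by
    rw [hU]; simp [out]; ring
  have u1 : expUtility a pbar (peak b δ) (b + 1) = a + δ := by
    rw [hU]; simp [out]; ring
  have u2 : expUtility a pbar (peak b δ) (b + 2) = 2 * a - b - 1 + (b + 2 - a) * δ := by
    rw [hU]; simp [out]; ring
  have ulow : ∀ c < b, expUtility a pbar (peak b δ) c = c := by
    intro c hc
    rw [hU]
    simp only [out, show ¬ b < c by omega, show ¬ b + 1 < c by omega, show ¬ b + 2 < c by omega,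
      hc, show c < b + 1 by omega, show c < b + 2 by omega, if_true, if_false]
    ring
  have uhigh : ∀ c, b + 2 < c → expUtility a pbar (peak b δ) c = 2 * a - b - 1 := by
    intro c hc
    rw [hU]
    simp only [out, show b < c by omega, show b + 1 < c by omega, hc, if_true]
    push_cast
    ring
  refine mkProfile_pureBid_mem_closure (K := b + 2) hvl hvh (by omega) (by omega)
    (fun t _ => ?_) ?_ (fun c _ hcb => ?_) (fun c _ hbc => ?_) (fun c _ c' _ hlt => ?_)
  · rcases hcases t with h | rfl | rfl | rfl | h
    · exact (p3 t (Or.inl h)).ge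
    · linarith
    · linarith
    · linarith
    · exact (p3 t (Or.inr h)).ge
  · simpa using (sum_mul_peak hbp δ fun _ => 1).trans (by ring)
  · rw [u0]
    rcases hcases c with h | h | rfl | rfl | h
    · rw [ulow c h]
      have : (c : ℝ) + 1 ≤ b := by exact_mod_cast h
      linarith
    · exact absurd h hcb
    · rw [u1]; linarith
    · rw [u2]; linarith
    · rw [uhigh c h]; linarith
  · rw [u2]
    rcases hcases c with h | h | rfl | rfl | h
    · omega
    · omega
    · rw [u1]; exact ⟨fun _ => by omega, fun _ => by linarith⟩
    · rw [u2]; simp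
    · rw [uhigh c h]; exact ⟨fun _ => by linarith, fun _ => by omega⟩
  · have hIoc : Finset.Ioc b (b + 2) = {b + 1, b + 2} := by
      ext t; simp only [Finset.mem_Ioc, Finset.mem_insert, Finset.mem_singleton]; omega
    have hc' : b ≤ c' ∧ c' ≤ b + 2 := by
      by_contra h
      rw [p3 c' (by omega)] at hlt
      rcases hcases c with h | rfl | rfl | rfl | h
      · exact absurd (p3 c (Or.inl h)) hlt.ne
      · linarith
      · linarith
      · linarith
      · exact absurd (p3 c (Or.inr h)) hlt.ne
    have hob : ∀ t, b ≤ t → out b t b = b := by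
      intro t ht
      rcases ht.eq_or_lt with rfl | ht
      · simp [out]
      · simp only [out, ht, if_true]
        ring
    rcases lt_or_ge c b with hcb | hcb
    · left
      rw [hob c' hc'.1]
      simp [out, hcb, hcb.not_gt]
    · refine Or.inr ⟨hcb, hc'.1, by rw [hob _ hcb, hob _ hc'.1], ?_⟩
      rw [hIoc, Finset.sum_pair (by omega), Finset.sum_pair (by omega)]
      have s0 : out b b (b + 1) + out b b (b + 2) = 2 * b := by simp [out]; ring
      have s1 : out b (b + 1) (b + 1) + out b (b + 1) (b + 2) = 2 * b + 1 := by
        simp [out]; ring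
      have s2 : out b (b + 2) (b + 1) + out b (b + 2) (b + 2) = 2 * b - 1 := by
        simp [out]; ring
      have s3 : ∀ c, b + 2 < c → out b c (b + 1) + out b c (b + 2) = 2 * b - 3 := by
        intro c hc
        simp only [out, show b + 1 < c by omega, hc, if_true]
        push_cast; ring
      obtain rfl | rfl | rfl : c' = b ∨ c' = b + 1 ∨ c' = b + 2 := by omega
      all_goals
        rcases hcases c with h | rfl | rfl | rfl | h
        · omega
        all_goals first
          | (exfalso; linarith)
          | (have := s3 c h; linarith)
          | linarith

theorem mkProfile_pureBid_succ_mem_closure {a b pbar : ℕ} {v : Agent → ℕ} {l : Agent}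
    (hvl : v l = 2 * a) (hvh : v (other l) = 2 * b) (hab : a < b) (hbp : b + 2 ≤ pbar) :
    mkProfile pbar l (pureBid b) (pureBid (b + 1)) ∈ closure {s | IsWeaklyPayoffMonotone v s} := by
  set F : ℝ → Profile pbar := fun δ => mkProfile pbar l (pureBid b) (peak b δ) with hF
  have hc : Continuous F := by
    refine continuous_pi fun i => continuous_pi fun c => ?_
    simp only [hF, mkProfile, peak]
    split_ifs <;> fun_prop
  have h0 : F 0 = mkProfile pbar l (pureBid b) (pureBid (b + 1)) := by
    ext i c; simp [hF, mkProfile, peak]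
  rw [← h0]
  have hlim : Tendsto F (𝓝[>] 0) (𝓝 (F 0)) := (hc.tendsto 0).mono_left nhdsWithin_le_nhds
  refine isClosed_closure.mem_of_tendsto hlim ?_
  have hev : ∀ᶠ δ : ℝ in 𝓝 0, 4 * ((b : ℝ) + 1) * δ < 1 :=
    ContinuousAt.eventually_lt (by fun_prop) (by fun_prop) (by simp)
  filter_upwards [hev.filter_mono nhdsWithin_le_nhds, self_mem_nhdsWithin] with δ h1 h2
  exact mkProfile_peak_mem_closure hvl hvh hab hbp h2 h1

/-! ### From limits of monotone profiles to empirical equilibria -/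

theorem continuous_bidUtility {pbar : ℕ} (v : Agent → ℕ) (i : Agent) (c : Bid pbar) :
    Continuous fun s : Profile pbar => bidUtility v s i c := by
  unfold bidUtility
  fun_prop

theorem bidUtility_le_of_mem_closure {pbar : ℕ} {v : Agent → ℕ} {τ : Profile pbar}
    (hτ : τ ∈ closure {s | IsWeaklyPayoffMonotone v s}) {i : Agent} {c c' : Bid pbar}
    (h : τ i c < τ i c') : bidUtility v τ i c ≤ bidUtility v τ i c' := by
  obtain ⟨s, hs, hlim⟩ := mem_closure_iff_seq_limit.1 hτ
  have hc : ∀ c, Tendsto (fun n => s n i c) atTop (𝓝 (τ i c)) :=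
    fun c => tendsto_pi_nhds.1 (tendsto_pi_nhds.1 hlim i) c
  refine le_of_tendsto_of_tendsto (((continuous_bidUtility v i c).tendsto τ).comp hlim)
    (((continuous_bidUtility v i c').tendsto τ).comp hlim) ?_
  filter_upwards [(hc c).eventually_lt (hc c') h] with n hn
  exact ((hs n).2 i _ _ hn).le

theorem isEmpirical_mkProfile_pureBid {a b d pbar : ℕ} {v : Agent → ℕ} {l : Agent}
    (hvl : v l = 2 * a) (hvh : v (other l) = 2 * b) (hdb : d ≤ b) (hd : d ≤ pbar) {g : ℕ → ℝ}
    (hg : ∀ t, 0 ≤ g t) (hg1 : ∑ t ∈ Finset.range (pbar + 1), g t = 1) (hg0 : ∀ t ≤ d, g t = 0)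
    (hcl : mkProfile pbar l (pureBid d) g ∈ closure {s | IsWeaklyPayoffMonotone v s}) :
    IsEmpirical v (mkProfile pbar l (pureBid d) g) ∧
      payoff v (mkProfile pbar l (pureBid d) g) l = d ∧
      payoff v (mkProfile pbar l (pureBid d) g) (other l) = 2 * b - d := by
  have hp0 : ∀ t, 0 ≤ pureBid d t := fun t => by unfold pureBid; split_ifs <;> norm_num
  have hout : ∀ c, d < c → out b c d = 2 * b - d := fun c hc => by simp [out, hc]
  refine ⟨⟨⟨isStrategyProfile_mkProfile (fun t _ => hp0 t) (fun t _ => hg t) (sum_pureBid hd) hg1,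
    fun i c hc c' => ?_⟩, ?_⟩, ?_, ?_⟩
  · by_cases hi : i = l
    · subst hi
      have hcd : (c : ℕ) = d := by
        by_contra h
        simp [mkProfile, pureBid, h] at hc
      by_cases hc' : (c' : ℕ) = d
      · rw [Fin.ext (hc'.trans hcd.symm)]
      -- The best-response property of `d` for `l` is inherited from the approximating profiles,
      -- since `d` has the strictly largest probability.
      · refine bidUtility_le_of_mem_closure hcl ?_
        simp [mkProfile, pureBid, hcd, hc']
    · obtain rfl := eq_other_of_ne hi
      have hdc : d < c := by
        by_contra h
        simp [mkProfile, other_ne, hg0 c (not_lt.1 h)] at hc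
      rw [bidUtility_mkProfile_right hvh, bidUtility_mkProfile_right hvh, expUtility_pureBid hd,
        expUtility_pureBid hd, hout c hdc]
      have hdb' : (d : ℝ) ≤ b := by exact_mod_cast hdb
      rcases lt_trichotomy (c' : ℕ) d with h | h | h
      · have h' : ((c' : ℕ) : ℝ) ≤ d := by exact_mod_cast h.le
        simp only [out, h, h.not_gt, if_true, if_false]
        linarith
      · simp only [out, h, lt_irrefl, if_false]
        linarith
      · exact (hout _ h).le
  · obtain ⟨s, hs, hlim⟩ := mem_closure_iff_seq_limit.1 hcl
    exact ⟨s, hs, hlim⟩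
  · have h1 : payoff v (mkProfile pbar l (pureBid d) g) l =
        ∑ c ∈ Finset.range (pbar + 1), pureBid d c * expUtility a pbar g c := by
      rw [← Fin.sum_univ_eq_sum_range (fun c => pureBid d c * expUtility a pbar g c)]
      refine Finset.sum_congr rfl fun c _ => ?_
      rw [bidUtility_mkProfile_left hvl]
      simp [mkProfile]
    have h2 : expUtility a pbar g d = ∑ t ∈ Finset.range (pbar + 1), d * g t := by
      refine Finset.sum_congr rfl fun t _ => ?_
      rcases le_or_gt t d with h | h
      · simp [hg0 t h]
      · simp [out, h, h.not_gt]
    rw [h1]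
    simp only [pureBid, ite_mul, one_mul, zero_mul, Finset.sum_ite_eq', Finset.mem_range,
      Nat.lt_succ_of_le hd, if_true]
    rw [h2, ← Finset.mul_sum, hg1, mul_one]
  · have h1 : payoff v (mkProfile pbar l (pureBid d) g) (other l) =
        ∑ c ∈ Finset.range (pbar + 1), g c * (2 * b - d) := by
      rw [← Fin.sum_univ_eq_sum_range (fun c => g c * (2 * b - d : ℝ))]
      refine Finset.sum_congr rfl fun c _ => ?_
      rw [bidUtility_mkProfile_right hvh, expUtility_pureBid hd]
      rcases le_or_gt (c : ℕ) d with h | h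
      · simp [mkProfile, other_ne, hg0 c h]
      · simp [mkProfile, other_ne, hout c h]
    rw [h1, ← Finset.sum_mul, hg1, one_mul]

theorem exists_isEmpirical_of_attainable {a b d pbar : ℕ} {v : Agent → ℕ} {l : Agent}
    (hvl : v l = 2 * a) (hvh : v (other l) = 2 * b) (hab : a < b) (hbp : b + 2 ≤ pbar)
    (had : a ≤ d) (h : Attainable a b pbar d) :
    ∃ τ : Profile pbar, IsEmpirical v τ ∧ payoff v τ l = d ∧
      payoff v τ (other l) = 2 * b - d := by
  rcases h with rfl | ⟨hdb, n, h1, h2, h3, h4, h5⟩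
  · refine ⟨_, isEmpirical_mkProfile_pureBid hvl hvh le_rfl (by omega) (fun t => ?_)
      (sum_pureBid (by omega)) (fun t ht => ?_)
      (mkProfile_pureBid_succ_mem_closure hvl hvh hab hbp)⟩
    · unfold pureBid; split_ifs <;> norm_num
    · simp [pureBid, show t ≠ d + 1 by omega]
  · have hdT : d < d + n := by omega
    have hpos : (0 : ℝ) < (d + n : ℕ) - d := sub_pos.2 (by exact_mod_cast hdT)
    refine ⟨_, isEmpirical_mkProfile_pureBid hvl hvh hdb.le (by omega)
      (spread_nonneg (one_div_nonneg.2 hpos.le) le_rfl) ?_ (fun t ht => ?_)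
      (mkProfile_uniform_mem_closure hvl hvh had hdT h2 (by omega) (by omega) hdb (by omega)
        (by omega))⟩
    · rw [sum_spread hdT h2, mul_zero, add_zero, mul_one_div_cancel hpos.ne']
    · simp [spread, not_lt.2 ht]

/-! ### Structure of efficient Nash equilibria -/

theorem bidUtility_eq_sum_out {pbar a : ℕ} {v : Agent → ℕ} {i : Agent} (hv : v i = 2 * a)
    (σ : Profile pbar) (c : Bid pbar) :
    bidUtility v σ i c = ∑ t : Bid pbar, out a c t * σ (other i) t :=
  Finset.sum_congr rfl fun t _ => by rw [outcomeUtility_eq_out hv]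

/-- In an efficient profile the lower-value agent never wins or ties. -/
theorem mul_eq_zero_of_efficient {pbar a b : ℕ} {v : Agent → ℕ} {l : Agent}
    (hvl : v l = 2 * a) (hvh : v (other l) = 2 * b) (hab : a < b) {σ : Profile pbar}
    (hσ : IsStrategyProfile σ) (heff : payoff v σ l + payoff v σ (other l) = 2 * b)
    {x y : Bid pbar} (hyx : y ≤ x) : σ l x * σ (other l) y = 0 := by
  have hab' : (a : ℝ) < b := by exact_mod_cast hab
  -- The surplus lost at each pair of bids, weighted by its probability: `2b - 2a` when `l` wins, `b
  -- - a` at a tie, zero otherwise. Efficiency makes the total vanish.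
  set F : Bid pbar → Bid pbar → ℝ :=
    fun x y => (2 * b - out a x y - out b y x) * (σ l x * σ (other l) y) with hF
  have hcoef : ∀ x y : Bid pbar, 0 ≤ 2 * b - out a x y - out b y x ∧
      (y ≤ x → 0 < 2 * b - out a x y - out b y x) := by
    intro x y
    rw [← Fin.val_fin_le]
    rcases lt_trichotomy (x : ℕ) y with h | h | h
    · simp only [out, h, h.not_gt, if_true, if_false]
      exact ⟨by linarith, fun h' => absurd h (not_lt.2 h')⟩
    · simp only [out, h, lt_irrefl, if_false]
      exact ⟨by linarith, fun _ => by linarith⟩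
    · simp only [out, h, h.not_gt, if_true, if_false]
      exact ⟨by linarith, fun _ => by linarith⟩
  have hF0 : ∀ x y, 0 ≤ F x y := fun x y =>
    mul_nonneg (hcoef x y).1 (mul_nonneg ((hσ l).1 x) ((hσ (other l)).1 y))
  have hsum : ∑ x, ∑ y, F x y = 0 := by
    have e1 : payoff v σ l = ∑ x : Bid pbar, ∑ y : Bid pbar, out a x y * (σ l x * σ (other l) y) := by
      refine Finset.sum_congr rfl fun x _ => ?_
      rw [bidUtility_eq_sum_out hvl, Finset.mul_sum]
      exact Finset.sum_congr rfl fun y _ => by ring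
    have e2 : payoff v σ (other l) =
        ∑ x : Bid pbar, ∑ y : Bid pbar, out b y x * (σ l x * σ (other l) y) := by
      rw [Finset.sum_comm]
      refine Finset.sum_congr rfl fun x _ => ?_
      rw [bidUtility_eq_sum_out hvh, Finset.mul_sum, other_other]
      exact Finset.sum_congr rfl fun y _ => by ring
    have e3 : ∑ x, ∑ y, (2 * b : ℝ) * (σ l x * σ (other l) y) = 2 * b := by
      simp only [← Finset.mul_sum, (hσ (other l)).2, (hσ l).2, mul_one]
    simp only [hF, sub_mul, Finset.sum_sub_distrib]
    rw [e3, ← e1, ← e2]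
    linarith
  have h1 := (Finset.sum_eq_zero_iff_of_nonneg fun x _ =>
    Finset.sum_nonneg fun y _ => hF0 x y).1 hsum x (Finset.mem_univ x)
  have h2 := (Finset.sum_eq_zero_iff_of_nonneg fun y _ => hF0 x y).1 h1 y (Finset.mem_univ y)
  exact (mul_eq_zero.1 h2).resolve_left ((hcoef x y).2 hyx).ne'

/-- In an efficient Nash equilibrium the lower-value agent plays a pure bid. -/
theorem exists_pureBid_of_efficient {pbar a b : ℕ} {v : Agent → ℕ} {l : Agent}
    (hvl : v l = 2 * a) (hvh : v (other l) = 2 * b) (hab : a < b) {σ : Profile pbar}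
    (hσ : IsNash v σ) (heff : payoff v σ l + payoff v σ (other l) = 2 * b) :
    ∃ d : Bid pbar, a ≤ (d : ℕ) ∧ (d : ℕ) ≤ b ∧ (d : ℕ) < pbar ∧ σ l d = 1 ∧
      (∀ c, c ≠ d → σ l c = 0) ∧ (∀ c, c ≤ d → σ (other l) c = 0) ∧
      (∀ c : Bid pbar, (c : ℕ) = d + 1 → 0 < σ (other l) c) ∧ payoff v σ l = ((d : ℕ) : ℝ) := by
  obtain ⟨hs, hnash⟩ := hσ
  have hzero : ∀ {x y : Bid pbar}, y ≤ x → σ l x * σ (other l) y = 0 :=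
    fun h => mul_eq_zero_of_efficient hvl hvh hab hs heff h
  have hex : ∀ i, ∃ c, 0 < σ i c := by
    intro i
    by_contra! h
    have h1 := (hs i).2
    rw [Finset.sum_eq_zero fun c _ => le_antisymm (h c) ((hs i).1 c)] at h1
    exact zero_ne_one h1
  obtain ⟨d, hd⟩ := hex l
  have hutil : ∀ x, 0 < σ l x → bidUtility v σ l x = ((x : ℕ) : ℝ) := by
    intro x hx
    have : ∀ t : Bid pbar, out a x t * σ (other l) t = (x : ℕ) * σ (other l) t := by
      intro t
      rcases le_or_gt t x with h | h
      · simp [(mul_eq_zero.1 (hzero h)).resolve_left hx.ne']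
      · have h' : (x : ℕ) < t := h
        simp [out, h', h'.not_gt]
    rw [bidUtility_eq_sum_out hvl, Finset.sum_congr rfl fun t _ => this t, ← Finset.mul_sum,
      (hs (other l)).2, mul_one]
  have hpure : ∀ c, c ≠ d → σ l c = 0 := by
    intro c hc
    by_contra h
    have hpos : 0 < σ l c := lt_of_le_of_ne ((hs l).1 c) (Ne.symm h)
    have h1 := hnash l c hpos d
    have h2 := hnash l d hd c
    rw [hutil c hpos, hutil d hd] at h1 h2
    exact hc (Fin.ext (by exact_mod_cast le_antisymm h2 h1))
  have hd1 : σ l d = 1 := by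
    rw [← (hs l).2, Finset.sum_eq_single d (fun c _ hc => hpure c hc) (by simp)]
  have hlow : ∀ c, c ≤ d → σ (other l) c = 0 := fun c hc =>
    (mul_eq_zero.1 (hzero hc)).resolve_left hd.ne'
  obtain ⟨y, hy⟩ := hex (other l)
  have hdy : (d : ℕ) < y := by
    by_contra h
    exact hy.ne' (hlow y (not_lt.1 h))
  have hdp : (d : ℕ) < pbar := by have := y.2; omega
  have hdb : (d : ℕ) ≤ b := by
    have hc : ∀ c : Bid pbar, bidUtility v σ (other l) c = out b c d := by
      intro c
      rw [bidUtility_eq_sum_out hvh, other_other, Finset.sum_eq_single d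
        (fun t _ ht => by rw [hpure t ht, mul_zero]) (by simp), hd1, mul_one]
    have h1 := hnash (other l) y hy d
    rw [hc, hc] at h1
    simp only [out, hdy, lt_irrefl, if_true, if_false] at h1
    exact_mod_cast (by linarith : ((d : ℕ) : ℝ) ≤ b)
  -- The bid `d + 1` would earn `l` more than `d` but for ties at `d + 1`. Hence `h` must put mass
  -- there, and a tie must be costly enough to force `a ≤ d`.
  set e : Bid pbar := ⟨d + 1, by omega⟩ with he
  have hue : bidUtility v σ l e = d + 1 + (a - (d + 1)) * σ (other l) e := by
    have : ∀ t : Bid pbar, out a e t * σ (other l) t =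
        (d + 1) * σ (other l) t + if t = e then (a - (d + 1)) * σ (other l) t else 0 := by
      intro t
      rcases lt_trichotomy t e with h | rfl | h
      · have h' : (t : ℕ) < d + 1 := h
        rw [hlow t (Nat.lt_succ_iff.1 h')]
        simp
      · simp [out, he]
        ring
      · have h' : (e : ℕ) < t := h
        simp only [out, h', h'.not_gt, h.ne', if_true, if_false, add_zero]
        simp [he]
    rw [bidUtility_eq_sum_out hvl, Finset.sum_congr rfl fun t _ => this t,
      Finset.sum_add_distrib, ← Finset.mul_sum, (hs (other l)).2, Finset.sum_ite_eq',
      if_pos (Finset.mem_univ e), mul_one]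
  have h1 := hnash l d hd e
  rw [hue, hutil d hd] at h1
  have he0 := (hs (other l)).1 e
  have hepos : 0 < σ (other l) e := by
    refine lt_of_le_of_ne he0 fun h => ?_
    rw [← h] at h1
    linarith
  refine ⟨d, ?_, hdb, hdp, hd1, hpure, hlow, ?_, ?_⟩
  · by_contra! h
    have h2 : ((d : ℕ) : ℝ) + 1 ≤ a := by exact_mod_cast h
    nlinarith [mul_nonneg (sub_nonneg.2 h2) he0]
  · intro c hc
    rwa [show c = e from Fin.ext hc]
  · rw [payoff, Finset.sum_eq_single d (fun c _ hc => by rw [hpure c hc, zero_mul]) (by simp),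
      hd1, one_mul, hutil d hd]

/-- The strict inequalities of the limit hold eventually along the sequence, so a single
approximating profile already provides every hypothesis of `attainable_of_payoffMonotone`. -/
theorem attainable_of_isEmpirical {pbar a b : ℕ} {v : Agent → ℕ} {l : Agent}
    (hvl : v l = 2 * a) (hvh : v (other l) = 2 * b) (hab : a < b) (hbp : b < pbar)
    {τ : Profile pbar} (hτ : IsEmpirical v τ)
    (heff : payoff v τ l + payoff v τ (other l) = 2 * b) {d : ℕ} (hd : payoff v τ l = d) :
    Attainable a b pbar d := by
  obtain ⟨hnash, s, hs, hlim⟩ := hτ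
  obtain ⟨d', had, hdb, hdp, hd1, hpure, hlow, hnext, hpay⟩ :=
    exists_pureBid_of_efficient hvl hvh hab hnash heff
  obtain rfl : d = d' := by exact_mod_cast hd.symm.trans hpay
  rcases hdb.eq_or_lt with h | hdb
  · exact Or.inl h
  have hc : ∀ i c, Tendsto (fun n => s n i c) atTop (𝓝 (τ i c)) :=
    fun i c => tendsto_pi_nhds.1 (tendsto_pi_nhds.1 hlim i) c
  set e : Bid pbar := ⟨d' + 1, by omega⟩ with he
  have hU : ∀ c : Bid pbar, bidUtility v τ (other l) c = out b c d' := by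
    intro c
    rw [bidUtility_eq_sum_out hvh, other_other, Finset.sum_eq_single d'
      (fun t _ ht => by rw [hpure t ht, mul_zero]) (by simp), hd1, mul_one]
  have ev1 : ∀ᶠ n in atTop, s n l e < s n l d' := by
    refine (hc l e).eventually_lt (hc l d') ?_
    rw [hd1, hpure e fun h => by simpa [he] using congrArg Fin.val h]
    exact one_pos
  have ev2 : ∀ᶠ n in atTop, ((d' : ℕ) - (a : ℝ)) * s n (other l) d' < s n (other l) e := by
    refine ((hc _ d').const_mul _).eventually_lt (hc _ e) ?_
    rw [hlow d' le_rfl, mul_zero]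
    exact hnext e rfl
  have ev3 : ∀ᶠ n in atTop, ∀ c : Bid pbar, d' < c →
      bidUtility v (s n) (other l) d' < bidUtility v (s n) (other l) c := by
    refine eventually_all.2 fun c => ?_
    by_cases h : d' < c
    · have hlt : bidUtility v τ (other l) d' < bidUtility v τ (other l) c := by
        have h' : (d' : ℕ) < c := h
        have hdb' : ((d' : ℕ) : ℝ) < b := by exact_mod_cast hdb
        rw [hU, hU]
        simp only [out, h', lt_irrefl, if_true, if_false]
        linarith
      exact ((((continuous_bidUtility v _ d').tendsto τ).comp hlim).eventually_lt
        (((continuous_bidUtility v _ c).tendsto τ).comp hlim) hlt).mono fun _ h _ => h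
    · exact Eventually.of_forall fun _ h' => absurd h' h
  obtain ⟨n, h1, h2, h3⟩ := (ev1.and (ev2.and ev3)).exists
  obtain ⟨hsn, hmono⟩ := hs n
  have hext : ∀ (i : Agent) (c : Bid pbar), extend (s n i) c = s n i c :=
    fun i c => extend_val _ _
  have hext0 : ∀ i t, 0 ≤ extend (s n i) t := by
    intro i t
    unfold extend
    split_ifs
    · exact (hsn i).1 _
    · exact le_rfl
  refine attainable_of_payoffMonotone (f := extend (s n l)) (g := extend (s n (other l)))
    had hdb hbp (hext0 _) (hext0 _) (fun c c' hcp hcp' hlt => ?_) (fun c c' hcp hcp' hlt => ?_)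
    ?_ (fun c hdc hcp => ?_) ?_
  · lift c to Bid pbar using Nat.lt_succ_of_le hcp
    lift c' to Bid pbar using Nat.lt_succ_of_le hcp'
    rw [hext, hext] at hlt
    simpa only [bidUtility_eq hvl] using hmono l c' c hlt
  · lift c to Bid pbar using Nat.lt_succ_of_le hcp
    lift c' to Bid pbar using Nat.lt_succ_of_le hcp'
    rw [hext, hext] at hlt
    simpa only [bidUtility_eq hvh, other_other] using hmono (other l) c' c hlt
  · rw [hext]
    exact (hext l e).trans_lt h1
  · lift c to Bid pbar using Nat.lt_succ_of_le hcp
    rw [hext, hext]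
    by_contra hlt
    exact absurd (hmono _ _ _ (not_le.1 hlt)) (h3 c hdc).not_gt
  · rw [hext]
    exact h2.trans_eq (hext _ e).symm

/-! ### Translation to the stated conditions -/

theorem payoff_add_payoff_of_isEfficient {pbar b : ℕ} {v : Agent → ℕ} {l : Agent}
    (hlh : v l < v (other l)) (hvh : v (other l) = 2 * b) {σ : Profile pbar}
    (heff : IsEfficient v σ) : payoff v σ l + payoff v σ (other l) = 2 * b := by
  have hmax : max (v 0) (v 1) = 2 * b := by
    rw [← hvh]
    fin_cases l
    · exact max_eq_right (Nat.le_of_lt hlh)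
    · exact max_eq_left (Nat.le_of_lt hlh)
  rw [IsEfficient, hmax, Fin.sum_univ_two] at heff
  push_cast at heff
  rw [← heff]
  fin_cases l
  · rfl
  · exact add_comm _ _

theorem ES_eq {a b : ℕ} {v : Agent → ℕ} {l : Agent} (hvl : v l = 2 * a)
    (hvh : v (other l) = 2 * b) (hab : a < b) : ES v = b - a := by
  have hab' : (a : ℝ) < b := by exact_mod_cast hab
  unfold ES
  fin_cases l
  · have h0 : v 0 = 2 * a := hvl
    have h1 : v 1 = 2 * b := hvh
    rw [h0, h1, abs_of_nonpos (by push_cast; linarith)]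
    push_cast; ring
  · have h0 : v 1 = 2 * a := hvl
    have h1 : v 0 = 2 * b := hvh
    rw [h0, h1, abs_of_nonneg (by push_cast; linarith)]
    push_cast; ring

end LoserBid

theorem theorem2 (vmin vmax pbar : ℕ) (hmin : Even vmin) (hmax : Even vmax)
    (hmin2 : 2 < vmin) (hminmax : vmin ≤ vmax) (hpbar : (vmax : ℝ) / 2 + 2 ≤ (pbar : ℝ))
    (v : LoserBid.Agent → ℕ) (hv : ∀ i, v i ∈ LoserBid.TypeSpace vmin vmax)
    (l h : LoserBid.Agent) (hlh : v l < v h)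
    (σ : LoserBid.Profile pbar) (hσ : LoserBid.IsNash v σ) (heff : LoserBid.IsEfficient v σ) :
    (∃ τ : LoserBid.Profile pbar, LoserBid.IsEmpirical v τ ∧
        ∀ i, LoserBid.payoff v τ i = LoserBid.payoff v σ i) ↔
      (LoserBid.ES v ≤ 2 →
        LoserBid.payoff v σ l ≥ (v l : ℝ) / 2 + LoserBid.ES v) ∧
      (LoserBid.ES v > 2 →
        (v h : ℝ) / 2 ≥ (v l : ℝ) / 2 + 5 * ((pbar : ℝ) - (v l : ℝ) / 2) / 8 →
        LoserBid.payoff v σ l ≥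
          (v l : ℝ) / 2 + LoserBid.ES v / 2 + ((pbar : ℝ) - (v h : ℝ) / 2) / 2 - 1 / 2) ∧
      (LoserBid.ES v > 2 →
        (v h : ℝ) / 2 < (v l : ℝ) / 2 + 5 * ((pbar : ℝ) - (v l : ℝ) / 2) / 8 →
        (v h : ℝ) / 2 > (pbar : ℝ) - 7 * ((pbar : ℝ) - (v l : ℝ) / 2) / 12 + 7 / 12 →
        LoserBid.payoff v σ l ≥ (v l : ℝ) / 2 + 4 * LoserBid.ES v / 5 - 4 / 5) ∧
      (LoserBid.ES v > 2 →
        (v h : ℝ) / 2 < (v l : ℝ) / 2 + 5 * ((pbar : ℝ) - (v l : ℝ) / 2) / 8 →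
        (v h : ℝ) / 2 ≤ (pbar : ℝ) - 7 * ((pbar : ℝ) - (v l : ℝ) / 2) / 12 + 7 / 12 →
        LoserBid.payoff v σ l > (v l : ℝ) / 2 + 4 * LoserBid.ES v / 5 - 4 / 5) := by
  obtain rfl : h = LoserBid.other l :=
    LoserBid.eq_other_of_ne fun h' => absurd hlh (by rw [h']; exact lt_irrefl _)
  obtain ⟨a, ha⟩ := (hv l).2.2
  obtain ⟨b, hb⟩ := (hv (LoserBid.other l)).2.2
  have hvl : v l = 2 * a := by omega
  have hvh : v (LoserBid.other l) = 2 * b := by omega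
  have hab : a < b := by omega
  have hbp : b + 2 ≤ pbar := by
    have h1 : (2 * b : ℝ) ≤ vmax := by
      exact_mod_cast hvh ▸ (hv (LoserBid.other l)).2.1
    exact_mod_cast (by linarith : (b : ℝ) + 2 ≤ pbar)
  have hsum := LoserBid.payoff_add_payoff_of_isEfficient hlh hvh heff
  obtain ⟨⟨d, hd⟩, had, hdb, -, -, -, -, -, hpay⟩ :=
    LoserBid.exists_pureBid_of_efficient hvl hvh hab hσ hsum
  simp only at had hdb hpay
  have hleft : (∃ τ : LoserBid.Profile pbar, LoserBid.IsEmpirical v τ ∧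
      ∀ i, LoserBid.payoff v τ i = LoserBid.payoff v σ i) ↔ LoserBid.Attainable a b pbar d := by
    constructor
    · rintro ⟨τ, hτ, hpi⟩
      exact LoserBid.attainable_of_isEmpirical hvl hvh hab (by omega) hτ
        (by rw [hpi, hpi, hsum]) ((hpi l).trans hpay)
    · intro hatt
      obtain ⟨τ, hτ, h1, h2⟩ :=
        LoserBid.exists_isEmpirical_of_attainable hvl hvh hab hbp had hatt
      refine ⟨τ, hτ, fun i => ?_⟩
      by_cases hi : i = l
      · rw [hi, h1, hpay]
      · rw [LoserBid.eq_other_of_ne hi, h2]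
        linarith
  -- Moved to the reals, the integer conditions agree with the stated ones clause by clause, up to
  -- linear rearrangement.
  have cast_le : ∀ m n : ℕ, m ≤ n ↔ (m : ℝ) ≤ n := fun m n => Nat.cast_le.symm
  have cast_lt : ∀ m n : ℕ, m < n ↔ (m : ℝ) < n := fun m n => Nat.cast_lt.symm
  rw [hleft, LoserBid.attainable_iff hab hbp had hdb, LoserBid.ES_eq hvl hvh hab, hpay, hvl, hvh]
  simp only [cast_le, cast_lt]
  push_cast
  refine and_congr (imp_congr ?_ ?_) (and_congr (imp_congr ?_ (imp_congr ?_ ?_))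
    (and_congr (imp_congr ?_ (imp_congr ?_ (imp_congr ?_ ?_)))
      (imp_congr ?_ (imp_congr ?_ (imp_congr ?_ ?_)))))
  all_goals constructor <;> intro <;> linarith
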